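/- Let $K$ be an algebraically closed field of characteristic $0$; varieties are irreducible. For subvarieties $X,Y\subseteq\mathbb{P}^n_K$, let the Hadamard product $X\odot Y$ be the Zariski closure of the set of points $[p_0q_0:\dots:p_nq_n]$ with $[p_0:\dots:p_n]\in X$, $[q_0:\dots:q_n]\in Y$ and not all $p_jq_j$ zero, and let $X_1\odot\cdots\odot X_\ell=(\cdots(X_1\odot X_2)\odot\cdots)\odot X_\ell$. Let $\ell\ge 1$ and $h_1,\dots,h_\ell\ge 0$ be integers and let $n\geq (h_1+1)\cdots(h_\ell+1)-1$. For generic linear subspaces $L_1,\dots,L_\ell$ of $\mathbb{P}^n$ of dimensions $h_1,\dots,h_\ell$ (that is, for all $(L_1,\dots,L_\ell)$ in some nonempty Zariski open subset of the product of Grassmannians $\mathbb{G}(h_1,n)\times\cdots\times\mathbb{G}(h_\ell,n)$, depending only on $K$, $n$ and $(h_1,\dots,h_\ell)$), the following holds. For all subvarieties $X_1,\dots,X_\ell$ of $\mathbb{P}^n$ with $X_i\subseteq L_i$ for every $i$, the Hadamard product $X_1\odot\cdots\odot X_\ell$ is a subvariety of $\mathbb{P}^n$ that is projectively equivalent to the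 product variety $X_1\times\cdots\times X_\ell$, embedded in $\mathbb{P}^n$ by $$X_1\times\cdots\times X_\ell\subseteq L_1\times\cdots\times L_\ell\cong\mathbb{P}^{h_1}\times\cdots\times\mathbb{P}^{h_\ell}\hookrightarrow\mathbb{P}^{(h_1+1)\cdots(h_\ell+1)-1}\subseteq\mathbb{P}^n,$$ where the isomorphisms $L_i\cong\mathbb{P}^{h_i}$ are any linear ones, the second map is the Segre embedding, and the last inclusion is that of any coordinate subspace; i.e. some element of $\mathrm{PGL}_{n+1}(K)$ maps one onto the other. In particular, if $X_1,\dots,X_\ell$ are all smooth, then $X_1\odot\cdots\odot X_\ell$ is smooth. -/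

import Mathlib

open MvPolynomial

noncomputable section

namespace HadamardVar

variable {K : Type*} [Field K]

/-- Projective `n`-space over `K`, with homogeneous coordinates `x_0, …, x_n`. -/
abbrev ProjSpace (K : Type*) [Field K] (n : ℕ) : Type _ :=
  Projectivization K (Fin (n + 1) → K)

/-- The common zeros in projective space of a set of polynomials (used for homogeneous ones, for
which vanishing does not depend on the representative of the point). -/
def projZeros {n : ℕ} (S : Set (MvPolynomial (Fin (n + 1)) K)) : Set (ProjSpace K n) :=
  {P | ∀ F ∈ S, eval P.rep F = 0}

/-- A subset of projective space is algebraic if it is the zero set of a family of homogeneous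
polynomials. -/
def IsAlgebraicSet {n : ℕ} (Z : Set (ProjSpace K n)) : Prop :=
  ∃ S : Set (MvPolynomial (Fin (n + 1)) K), (∀ F ∈ S, ∃ d, F.IsHomogeneous d) ∧ Z = projZeros S

theorem isAlgebraicSet_empty {n : ℕ} : IsAlgebraicSet (∅ : Set (ProjSpace K n)) := by
  refine ⟨{1}, ?_, ?_⟩
  · rintro F rfl
    exact ⟨0, isHomogeneous_one _ _⟩
  · ext P
    simp [projZeros]

theorem isAlgebraicSet_sInter {n : ℕ} (A : Set (Set (ProjSpace K n)))
    (hA : ∀ Z ∈ A, IsAlgebraicSet Z) : IsAlgebraicSet (⋂₀ A) := by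
  choose! S hS hZ using hA
  refine ⟨⋃ Z ∈ A, S Z, ?_, ?_⟩
  · intro F hF
    simp only [Set.mem_iUnion] at hF
    obtain ⟨Z, hZA, hF⟩ := hF
    exact hS Z hZA F hF
  · ext P
    simp only [Set.mem_sInter, projZeros, Set.mem_iUnion, Set.mem_ofPred_eq]
    constructor
    · rintro h F ⟨Z, hZA, hF⟩
      have hP := h Z hZA
      rw [hZ Z hZA] at hP
      exact hP F hF
    · intro h Z hZA
      rw [hZ Z hZA]
      exact fun F hF => h F ⟨Z, hZA, hF⟩

theorem isAlgebraicSet_union {n : ℕ} (A B : Set (ProjSpace K n))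
    (hA : IsAlgebraicSet A) (hB : IsAlgebraicSet B) : IsAlgebraicSet (A ∪ B) := by
  obtain ⟨S, hS, rfl⟩ := hA
  obtain ⟨T, hT, rfl⟩ := hB
  refine ⟨{F | ∃ G ∈ S, ∃ H ∈ T, F = G * H}, ?_, ?_⟩
  · rintro F ⟨G, hG, H, hH, rfl⟩
    obtain ⟨a, ha⟩ := hS G hG
    obtain ⟨b, hb⟩ := hT H hH
    exact ⟨a + b, ha.mul hb⟩
  · ext P
    simp only [projZeros, Set.mem_union, Set.mem_ofPred_eq]
    constructor
    · rintro (h | h) F ⟨G, hG, H, hH, rfl⟩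
      · simp [h G hG]
      · simp [h H hH]
    · intro h
      by_contra! hc
      obtain ⟨⟨G, hG, hG0⟩, ⟨H, hH, hH0⟩⟩ := hc
      have := h _ ⟨G, hG, H, hH, rfl⟩
      rw [map_mul] at this
      exact (mul_ne_zero hG0 hH0) this

/-- The Zariski topology: the closed sets are the algebraic sets. -/
instance zariskiTopology {n : ℕ} : TopologicalSpace (ProjSpace K n) :=
  TopologicalSpace.ofClosed {Z | IsAlgebraicSet Z} isAlgebraicSet_empty
    (fun A hA => isAlgebraicSet_sInter A hA)
    (fun A hA B hB => isAlgebraicSet_union A B hA hB)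

/-- A projective (sub)variety: a Zariski closed, irreducible (in particular nonempty) subset. -/
def IsVariety {n : ℕ} (X : Set (ProjSpace K n)) : Prop :=
  IsClosed X ∧ IsIrreducible X

/-! ### Hadamard products -/

/-- The closure of the set of all coordinatewise products `p ⋆ q`, `p ∈ X`, `q ∈ Y`, that are
defined, i.e. have a nonzero coordinate. -/
def hadamard {n : ℕ} (X Y : Set (ProjSpace K n)) : Set (ProjSpace K n) :=
  closure {R | ∃ (p q : Fin (n + 1) → K) (hp : p ≠ 0) (hq : q ≠ 0) (hpq : p * q ≠ 0),
    Projectivization.mk K p hp ∈ X ∧ Projectivization.mk K q hq ∈ Y ∧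
      R = Projectivization.mk K (p * q) hpq}

/-- The iterated Hadamard product `(⋯((X_0 ⋆ X_1) ⋆ X_2) ⋆ ⋯) ⋆ X_ℓ`. -/
def hadamardProd {n : ℕ} : (ℓ : ℕ) → (Fin (ℓ + 1) → Set (ProjSpace K n)) → Set (ProjSpace K n)
  | 0, X => X 0
  | ℓ + 1, X => hadamard (hadamardProd ℓ fun i => X i.castSucc) (X (Fin.last (ℓ + 1)))

/-! ### Linear subspaces and genericity -/

/-- Linear subspaces of dimension `h` of projective `n`-space, as `(h+1)`-dimensional vector
subspaces of `K^(n+1)`. -/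
def Grass (K : Type*) [Field K] (n h : ℕ) : Type _ :=
  {W : Submodule K (Fin (n + 1) → K) // Module.finrank K W = h + 1}

/-- The points of the linear subspace of projective space defined by a vector subspace. -/
def linearPoints {n : ℕ} (W : Submodule K (Fin (n + 1) → K)) : Set (ProjSpace K n) :=
  {P | P.submodule ≤ W}

/-- A tuple of matrices, the `i`-th of size `(n+1) × (h_i+1)`, as a point of affine space. -/
def flatten {m n : ℕ} {h : Fin m → ℕ}
    (A : ∀ i, Matrix (Fin (n + 1)) (Fin (h i + 1)) K) :
    (Σ i : Fin m, Fin (n + 1) × Fin (h i + 1)) → K :=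
  fun s => A s.1 s.2.1 s.2.2

/-- Zariski open subsets of the product of Grassmannians `∏ᵢ 𝔾(h_i, n)`. This product is the
quotient of the variety of tuples of matrices with linearly independent columns by column
operations (a tuple is sent to the column spaces), and a set is open iff its preimage among these
tuples is the complement of an affine algebraic set. -/
def IsOpenGrass {m n : ℕ} {h : Fin m → ℕ} (U : Set (∀ i, Grass K n (h i))) : Prop :=
  ∃ I : Ideal (MvPolynomial (Σ i : Fin m, Fin (n + 1) × Fin (h i + 1)) K),
    ∀ (A : ∀ i, Matrix (Fin (n + 1)) (Fin (h i + 1)) K) (L : ∀ i, Grass K n (h i)),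
      (∀ i, (L i).1 = LinearMap.range (A i).mulVecLin) →
        (L ∈ U ↔ flatten A ∉ zeroLocus K I)

/-! ### Product varieties -/

/-- The vector of all products `∏ᵢ y_i (J i)`, one for each multi-index `J`, placed in the
coordinates `e J`; the remaining coordinates are zero. -/
def segreVec {m n : ℕ} {h : Fin m → ℕ} (e : (∀ i, Fin (h i + 1)) ↪ Fin (n + 1))
    (y : ∀ i, Fin (h i + 1) → K) : Fin (n + 1) → K :=
  Function.extend e (fun J => ∏ i, y i (J i)) 0

theorem segreVec_ne_zero {m n : ℕ} {h : Fin m → ℕ} (e : (∀ i, Fin (h i + 1)) ↪ Fin (n + 1))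
    (y : ∀ i, Fin (h i + 1) → K) (hy : ∀ i, y i ≠ 0) : segreVec e y ≠ 0 := by
  have hJ : ∀ i, ∃ j, y i j ≠ 0 := fun i => Function.ne_iff.mp (hy i)
  choose J hJ using hJ
  refine Function.ne_iff.mpr ⟨e J, ?_⟩
  simp only [segreVec, e.injective.extend_apply, Pi.zero_apply]
  exact Finset.prod_ne_zero_iff.mpr fun i _ => hJ i

/-- The Segre embedding of `ℙ^{h_1} × ⋯ × ℙ^{h_m}` into `ℙ^n`, for `n + 1 ≥ ∏ (h_i + 1)`: the usual
Segre embedding followed by the inclusion of a coordinate subspace. -/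
def segre {m n : ℕ} {h : Fin m → ℕ} (e : (∀ i, Fin (h i + 1)) ↪ Fin (n + 1))
    (P : ∀ i, ProjSpace K (h i)) : ProjSpace K n :=
  Projectivization.mk K (segreVec e fun i => (P i).rep)
    (segreVec_ne_zero e _ fun i => (P i).rep_nonzero)

/-- The product variety `X_1 × ⋯ × X_m` as a subset of `ℙ^n`: each `X_i` is transported to
`ℙ^{h_i}` by the linear parametrization `φ_i : ℙ^{h_i} → ℙ^n` of a linear subspace containing it, and
the product is embedded by the Segre embedding. -/
def productVariety {m n : ℕ} {h : Fin m → ℕ} (e : (∀ i, Fin (h i + 1)) ↪ Fin (n + 1))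
    (φ : ∀ i, (Fin (h i + 1) → K) →ₗ[K] (Fin (n + 1) → K))
    (hφ : ∀ i, Function.Injective (φ i)) (X : Fin m → Set (ProjSpace K n)) :
    Set (ProjSpace K n) :=
  segre e '' {P | ∀ i, Projectivization.map (φ i) (hφ i) (P i) ∈ X i}

/-- Two subsets of `ℙ^n` are projectively equivalent if a projective automorphism of `ℙ^n` maps one
onto the other. -/
def ProjectivelyEquivalent {n : ℕ} (X Y : Set (ProjSpace K n)) : Prop :=
  ∃ g : (Fin (n + 1) → K) ≃ₗ[K] (Fin (n + 1) → K),
    Projectivization.map g.toLinearMap g.injective '' X = Y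

/-! ### Smoothness -/

/-- The homogeneous ideal of `X`, generated by the homogeneous polynomials vanishing on `X`. -/
def homogeneousIdeal {n : ℕ} (X : Set (ProjSpace K n)) : Ideal (MvPolynomial (Fin (n + 1)) K) :=
  Ideal.span {F | (∃ d, F.IsHomogeneous d) ∧ ∀ P ∈ X, eval P.rep F = 0}

/-- The vector subspace of `K^(n+1)` of the embedded projective tangent space to `X` at the point
`[v]`: the kernel of the Jacobian matrix, at `v`, of the homogeneous ideal of `X`. -/
def tangentSpace {n : ℕ} (X : Set (ProjSpace K n)) (v : Fin (n + 1) → K) :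
    Submodule K (Fin (n + 1) → K) where
  carrier := {w | ∀ F ∈ homogeneousIdeal X, ∑ j, eval v (pderiv j F) * w j = 0}
  zero_mem' := by simp
  add_mem' := by
    intro a b ha hb F hF
    simp [mul_add, Finset.sum_add_distrib, ha F hF, hb F hF]
  smul_mem' := by
    intro c a ha F hF
    simp only [Pi.smul_apply, smul_eq_mul, mul_left_comm _ c, ← Finset.mul_sum, ha F hF, mul_zero]

/-- A variety `X` is smooth if at each of its points the projective tangent space has dimension
`dim X`. Both sides below are one more than these dimensions: the tangent space is represented by a
vector space, and `dim X + 1` is the Krull dimension of the homogeneous coordinate ring of `X`. -/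
def IsSmooth {n : ℕ} (X : Set (ProjSpace K n)) : Prop :=
  ∀ (v : Fin (n + 1) → K) (hv : v ≠ 0), Projectivization.mk K v hv ∈ X →
    (Module.finrank K (tangentSpace X v) : WithBot ℕ∞) =
      ringKrullDim (MvPolynomial (Fin (n + 1)) K ⧸ homogeneousIdeal X)

end HadamardVar

end

/-!
For generic linear subspaces `L₁, …, L_ℓ` the multiplication map `L₁ ⊗ ⋯ ⊗ L_ℓ → K^(n+1)` is
injective, because this amounts to the nonvanishing of a maximal minor of its matrix. The
coordinatewise product of vectors of the `L_i` is then the Segre map followed by an injective linear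
map, which extends to an automorphism of `K^(n+1)`.

It remains to see that no closure is needed and that smoothness is inherited; by induction, this
concerns the product of `X ⊆ V` and `Y ⊆ W`, where `V ⊗ W → K^(n+1)` is injective. There are linear
maps recovering either factor of a product up to a scalar, so that a point of the closure factors
too, and the tangent space at `p * q` is the sum of `T_p X * q` and `p * T_q Y`, which meet in the
line through `p * q`. Hence tangent spaces of the product have constant dimension if those of `X`
and `Y` do. Constant dimension implies smoothness, because some tangent space always has the
dimension of the homogeneous coordinate ring: over an infinite field, every cone has a Zariski dense
set of `K`-points, which makes its function field separably generated.
-/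

noncomputable section

namespace HadamardVar

/-! ### Derivations at rational points -/

section Derivations

open TensorProduct KaehlerDifferential

theorem ringKrullDim_eq_of_isIntegral {A B : Type*} [CommRing A] [CommRing B] [Algebra A B]
    [Algebra.IsIntegral A B] [FaithfulSMul A B] : ringKrullDim B = ringKrullDim A := by
  apply le_antisymm
  · exact Order.krullDim_le_of_strictMono (PrimeSpectrum.comap (algebraMap A B))
      fun P Q h => Ideal.IsIntegral.comap_lt_comap (I := P.asIdeal) (J := Q.asIdeal) h
  · refine iSup_le fun p => ?_
    obtain ⟨P, hP⟩ := Ideal.nonempty_primesOver (S := B) p.head.asIdeal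
    have := hP.1
    have := hP.2
    obtain ⟨q, hq, -⟩ := Ideal.exists_ltSeries_of_hasGoingUp p P
    rw [← hq]
    exact le_iSup (fun q : LTSeries (PrimeSpectrum B) => (q.length : WithBot ℕ∞)) q

theorem toNat_trdeg_eq_of_isAlgebraic (K R S : Type*) [Field K] [CommRing R] [IsDomain R]
    [CommRing S] [IsDomain S] [Algebra K R] [Algebra K S] [Algebra R S] [IsScalarTower K R S]
    [FaithfulSMul R S] [Algebra.IsAlgebraic R S] :
    Cardinal.toNat (Algebra.trdeg K S) = Cardinal.toNat (Algebra.trdeg K R) := by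
  have := congrArg Cardinal.toNat (lift_trdeg_add_eq K R S)
  simpa [trdeg_eq_zero (R := R)] using this.symm

theorem ringKrullDim_eq_toNat_trdeg (K R : Type*) [Field K] [CommRing R] [IsDomain R] [Algebra K R]
    [Algebra.FiniteType K R] : ringKrullDim R = Cardinal.toNat (Algebra.trdeg K R) := by
  obtain ⟨s, f, hf, hfin⟩ := exists_finite_inj_algHom_of_fg K R
  let := f.toAlgebra
  have : Module.Finite (MvPolynomial (Fin s) K) R := hfin
  have : IsScalarTower K (MvPolynomial (Fin s) K) R := .of_algHom f
  have : FaithfulSMul (MvPolynomial (Fin s) K) R :=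
    (faithfulSMul_iff_algebraMap_injective _ _).mpr hf
  rw [toNat_trdeg_eq_of_isAlgebraic K (MvPolynomial (Fin s) K) R, MvPolynomial.trdeg_of_isDomain,
    ringKrullDim_eq_of_isIntegral (A := MvPolynomial (Fin s) K),
    MvPolynomial.ringKrullDim_of_isNoetherianRing, ringKrullDim_eq_zero_of_field]
  simp

theorem linearIndependent_pow_of_expChar {K X ι : Type*} [Field K] (p : ℕ) [ExpChar K p]
    {f : ι → X → K} (hf : LinearIndependent K f) : LinearIndependent K fun i => f i ^ p := by
  -- Replacing the coefficients of a relation between the `f i ^ p` by `p`-th roots, which exist in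
  -- an algebraic closure, gives a relation between the `f i`.
  rw [linearIndependent_iff'] at hf ⊢
  intro s c hc i hi
  have : ExpChar (AlgebraicClosure K) p :=
    expChar_of_injective_algebraMap (algebraMap K (AlgebraicClosure K)).injective p
  choose d hd using fun i => IsAlgClosed.exists_pow_nat_eq (algebraMap K (AlgebraicClosure K) (c i))
    (expChar_pos K p)
  have hsum (x : X) : ∑ j ∈ s, f j x • d j = 0 := by
    have hcx := congrArg (algebraMap K (AlgebraicClosure K)) (congrFun hc x)
    rw [← pow_eq_zero_iff (expChar_pos K p).ne', sum_pow_char]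
    simpa [Algebra.smul_def, mul_pow, hd, mul_comm] using hcx
  let b := Module.Basis.ofVectorSpace K (AlgebraicClosure K)
  have hdi : d i = 0 := by
    refine b.ext_elem_iff.mpr fun k => ?_
    have hk : ∑ j ∈ s, b.coord k (d j) • f j = 0 := by
      ext x
      simpa [mul_comm] using congrArg (b.coord k) (hsum x)
    simpa using hf s _ hk i hi
  have hci := hd i
  rwa [hdi, zero_pow (expChar_pos K p).ne', eq_comm, map_eq_zero] at hci

theorem linearIndependent_pow_of_forall_algHom {K R ι : Type*} [Field K] [CommRing R] [Algebra K R]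
    (hR : ∀ f : R, (∀ x : R →ₐ[K] K, x f = 0) → f = 0) (p : ℕ) [ExpChar K p] {f : ι → R}
    (hf : LinearIndependent K f) : LinearIndependent K fun i => f i ^ p := by
  let evalPoints : R →ₗ[K] (R →ₐ[K] K) → K := LinearMap.pi fun x => x.toLinearMap
  have hinj : LinearMap.ker evalPoints = ⊥ :=
    LinearMap.ker_eq_bot'.mpr fun f hf => hR f fun x => congrFun hf x
  refine .of_comp evalPoints ?_
  convert linearIndependent_pow_of_expChar p (hf.map' evalPoints hinj) using 1
  ext i x
  simp [evalPoints]

theorem exists_isTranscendenceBasis_and_isSeparable_of_forall_algHom (K R F : Type*) [Field K]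
    [CommRing R] [IsDomain R] [Algebra K R] [Algebra.FiniteType K R] [Field F] [Algebra R F]
    [IsFractionRing R F] [Algebra K F] [IsScalarTower K R F]
    (hR : ∀ f : R, (∀ x : R →ₐ[K] K, x f = 0) → f = 0) :
    ∃ s : Finset F, IsTranscendenceBasis K ((↑) : s → F) ∧
      Algebra.IsSeparable (IntermediateField.adjoin K (s : Set F)) F := by
  have : Algebra.EssFiniteType R F := .of_isLocalization _ (nonZeroDivisors R)
  have : Algebra.EssFiniteType K F := .comp K R F
  obtain _ | ⟨p, hp, hpK⟩ := CharP.exists' K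
  · exact exists_isTranscendenceBasis_and_isSeparable_of_perfectField K F
  have : ExpChar K p := .prime hp.out
  have : ExpChar F p := expChar_of_injective_algebraMap (algebraMap K F).injective p
  -- By Mac Lane's criterion it suffices that `p`-th powers preserve linear independence over `K`.
  refine exists_isTranscendenceBasis_and_isSeparable_of_linearIndepOn_pow_of_essFiniteType p hp.out
    fun s hs => ?_
  obtain ⟨⟨b, hb⟩, hbs⟩ := IsLocalization.exist_integer_multiples_of_finset (nonZeroDivisors R) s
  choose r hr using fun a : s => hbs a a.2
  have hb0 : algebraMap R F b ≠ 0 := IsFractionRing.to_map_ne_zero_of_mem_nonZeroDivisors hb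
  have mul_injective {c : F} (hc : c ≠ 0) : LinearMap.ker (LinearMap.mulLeft K c) = ⊥ :=
    LinearMap.ker_eq_bot.mpr (mul_right_injective₀ hc)
  have hs' : LinearIndependent K fun a : s => (a : F) := hs
  have hr_indep : LinearIndependent K r := by
    refine .of_comp (IsScalarTower.toAlgHom K R F).toLinearMap ?_
    simpa [Function.comp_def, hr, Algebra.smul_def] using hs'.map' _ (mul_injective hb0)
  have hrp_indep := (linearIndependent_pow_of_forall_algHom hR p hr_indep).map'
    (IsScalarTower.toAlgHom K R F).toLinearMap
    (LinearMap.ker_eq_bot.mpr (IsFractionRing.injective R F))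
  have hsp_indep : LinearIndependent K fun a : s => (a : F) ^ p := by
    refine .of_comp (LinearMap.mulLeft K (algebraMap R F b ^ p)) ?_
    simpa [Function.comp_def, hr, Algebra.smul_def, mul_pow] using hrp_indep
  exact hsp_indep

open scoped IntermediateField.algebraAdjoinAdjoin in
theorem finrank_kaehlerDifferential_of_isSeparable {K F ι : Type*} [Field K] [Field F]
    [Algebra K F] {x : ι → F} (hx : AlgebraicIndependent K x)
    [Algebra.IsSeparable (IntermediateField.adjoin K (Set.range x)) F] :
    Module.finrank F Ω[F⁄K] = Nat.card ι := by
  let A := Algebra.adjoin K (Set.range x)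
  let E := IntermediateField.adjoin K (Set.range x)
  have : Algebra.FormallyEtale A E := .of_isLocalization (nonZeroDivisors _)
  have : Algebra.FormallyEtale E F := .of_isSeparable E F
  have : Algebra.FormallyEtale A F := .comp A E F
  let := (MvPolynomial.aeval (R := K) x).toAlgebra
  let := hx.aevalEquiv.toAlgHom.toAlgebra
  have : IsScalarTower K (MvPolynomial ι K) F := .of_algHom (MvPolynomial.aeval x)
  have : IsScalarTower (MvPolynomial ι K) A F :=
    .of_algebraMap_eq fun p => (hx.algebraMap_aevalEquiv p).symm
  have : Algebra.FormallyEtale (MvPolynomial ι K) A :=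
    .of_equiv (AlgEquiv.ofBijective (Algebra.ofId _ _) hx.aevalEquiv.bijective)
  have : Algebra.FormallyEtale (MvPolynomial ι K) F := .comp _ A F
  rw [← (tensorKaehlerEquivOfFormallyEtale K (MvPolynomial ι K) F).finrank_eq,
    Module.finrank_eq_nat_card_basis ((mvPolynomialBasis K ι).baseChange F)]

theorem finrank_derivation_eq (K : Type*) {R : Type*} [Field K] [CommRing R] [Algebra K R]
    (L : Type*) [Field L] [Algebra R L] [Algebra K L] [IsScalarTower K R L] :
    Module.finrank L (Derivation K R L) = Module.finrank L (L ⊗[R] Ω[R⁄K]) := by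
  let e : (Ω[R⁄K] →ₗ[R] L) ≃ₗ[L] Derivation K R L :=
    { linearMapEquivDerivation K R with
      map_smul' := fun c f => by ext; simp }
  rw [← e.finrank_eq, (LinearMap.liftBaseChangeEquiv L).finrank_eq]
  exact Subspace.dual_finrank_eq

theorem finrank_tensorProduct_eq_of_free_away {R M : Type*} [CommRing R] [AddCommGroup M]
    [Module R M] (g : R) [Module.Free (Localization (.powers g)) (LocalizedModule.Away g M)]
    (L : Type*) [Field L] [Algebra R L] (hg : algebraMap R L g ≠ 0) :
    Module.finrank L (L ⊗[R] M) =
      Module.finrank (Localization (.powers g)) (LocalizedModule.Away g M) := by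
  let f : Localization (.powers g) →+* L := IsLocalization.Away.lift g (isUnit_iff_ne_zero.mpr hg)
  let := f.toAlgebra
  have : IsScalarTower R (Localization (.powers g)) L :=
    .of_algebraMap_eq fun x => (IsLocalization.Away.lift_eq g (isUnit_iff_ne_zero.mpr hg) x).symm
  let e₁ := (IsLocalizedModule.isBaseChange (.powers g) (Localization (.powers g))
    (LocalizedModule.mkLinearMap (.powers g) M)).equiv
  let e₂ := TensorProduct.AlgebraTensorModule.cancelBaseChange R (Localization (.powers g)) L L M
  have : Module.Free (Localization (.powers g)) (Localization (.powers g) ⊗[R] M) :=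
    .of_equiv e₁.symm
  have : Nontrivial (Localization (.powers g)) := f.domain_nontrivial
  rw [← e₂.finrank_eq, Module.finrank_baseChange, e₁.finrank_eq]

theorem finrank_kaehlerDifferential_fractionRing (K R F : Type*) [Field K] [CommRing R] [IsDomain R]
    [Algebra K R] [Algebra.FiniteType K R] [Field F] [Algebra R F] [IsFractionRing R F]
    [Algebra K F] [IsScalarTower K R F] (hR : ∀ f : R, (∀ x : R →ₐ[K] K, x f = 0) → f = 0) :
    (Module.finrank F Ω[F⁄K] : WithBot ℕ∞) = ringKrullDim R := by
  obtain ⟨s, hs, hsep⟩ :=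
    exists_isTranscendenceBasis_and_isSeparable_of_forall_algHom K R F hR
  have : Algebra.IsSeparable (IntermediateField.adjoin K (Set.range ((↑) : s → F))) F := by
    rwa [Subtype.range_coe_subtype]
  have : Algebra.IsAlgebraic R F := IsLocalization.isAlgebraic F (nonZeroDivisors R)
  rw [finrank_kaehlerDifferential_of_isSeparable hs.1, ringKrullDim_eq_toNat_trdeg K R,
    ← toNat_trdeg_eq_of_isAlgebraic K R F, ← hs.cardinalMk_eq_trdeg]
  rfl

theorem exists_finrank_derivation_eq_ringKrullDim (K R : Type*) [Field K] [CommRing R] [IsDomain R]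
    [Algebra K R] [Algebra.FiniteType K R] (hR : ∀ f : R, (∀ x : R →ₐ[K] K, x f = 0) → f = 0) :
    ∃ g : R, g ≠ 0 ∧ ∀ (L : Type*) [Field L] [Algebra R L] [Algebra K L] [IsScalarTower K R L],
      algebraMap R L g ≠ 0 →
        (Module.finrank L (Derivation K R L) : WithBot ℕ∞) = ringKrullDim R := by
  have : IsNoetherianRing R := Algebra.FiniteType.isNoetherianRing K R
  have : Module.FinitePresentation R Ω[R⁄K] := Module.finitePresentation_of_finite R _
  obtain ⟨g, hg, _, hgrank⟩ := Module.FinitePresentation.exists_free_localizedModule_powers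
    (nonZeroDivisors R) (KaehlerDifferential.map K K R (FractionRing R)) (FractionRing R)
  refine ⟨g, nonZeroDivisors.ne_zero hg, fun L _ _ _ _ hgL => ?_⟩
  rw [finrank_derivation_eq, finrank_tensorProduct_eq_of_free_away g L hgL, hgrank,
    finrank_kaehlerDifferential_fractionRing K R (FractionRing R) hR]

end Derivations

/-! ### Affine cones and forms -/

section Cone

variable {K V : Type*} [Field K] [AddCommGroup V] [Module K V]

/-- The affine cone over a set of points of a projective space, without its vertex. It turns
statements about points of projective space into statements about vectors. -/
def cone (X : Set (Projectivization K V)) : Set V :=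
  {v | ∃ hv : v ≠ 0, Projectivization.mk K v hv ∈ X}

variable {X Y : Set (Projectivization K V)} {v : V}

theorem mem_cone_iff (hv : v ≠ 0) : v ∈ cone X ↔ Projectivization.mk K v hv ∈ X :=
  ⟨fun h => h.2, fun h => ⟨hv, h⟩⟩

theorem ne_zero_of_mem_cone (hv : v ∈ cone X) : v ≠ 0 := hv.1

theorem rep_mem_cone {P : Projectivization K V} : P.rep ∈ cone X ↔ P ∈ X := by
  rw [mem_cone_iff P.rep_nonzero, P.mk_rep]

theorem smul_mem_cone {c : K} (hc : c ≠ 0) (hv : v ∈ cone X) : c • v ∈ cone X := by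
  obtain ⟨hv0, hvX⟩ := hv
  rwa [mem_cone_iff (smul_ne_zero hc hv0),
    (Projectivization.mk_eq_mk_iff' K (c • v) v (smul_ne_zero hc hv0) hv0).mpr ⟨c, rfl⟩]

theorem cone_nonempty : (cone X).Nonempty ↔ X.Nonempty :=
  ⟨fun ⟨_, hv⟩ => ⟨_, hv.2⟩, fun ⟨_, hP⟩ => ⟨_, rep_mem_cone.mpr hP⟩⟩

theorem cone_injective : Function.Injective (cone : Set (Projectivization K V) → Set V) :=
  fun X Y h => Set.ext fun P => by rw [← rep_mem_cone, h, rep_mem_cone]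

theorem cone_image_map (g : V ≃ₗ[K] V) :
    cone (Projectivization.map g.toLinearMap g.injective '' X) = g '' cone X := by
  ext w
  constructor
  · obtain ⟨v, rfl⟩ := g.surjective w
    rintro ⟨hgv, P, hPX, hP⟩
    have hv : v ≠ 0 := g.map_ne_zero_iff.mp hgv
    have hPv : P = Projectivization.mk K v hv :=
      Projectivization.map_injective _ g.injective (hP.trans (Projectivization.map_mk _ _ _ _).symm)
    exact ⟨v, ⟨hv, hPv ▸ hPX⟩, rfl⟩
  · rintro ⟨v, ⟨hv, hvX⟩, rfl⟩
    exact ⟨g.map_ne_zero_iff.mpr hv, _, hvX, Projectivization.map_mk _ _ _ _⟩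

end Cone

section Forms

variable {K : Type*} [Field K] {n : ℕ} {X : Set (ProjSpace K n)}
  {F : MvPolynomial (Fin (n + 1)) K}

theorem cone_subset_of_subset_linearPoints {W : Submodule K (Fin (n + 1) → K)}
    (hX : X ⊆ linearPoints W) : cone X ⊆ W := fun v ⟨hv, hvX⟩ => by
  simpa [linearPoints, Projectivization.submodule_mk] using hX hvX

theorem eval_smul_of_isHomogeneous {R σ : Type*} [CommSemiring R] {F : MvPolynomial σ R} {d : ℕ}
    (hF : F.IsHomogeneous d) (c : R) (v : σ → R) : eval (c • v) F = c ^ d * eval v F := by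
  rw [eval_eq, eval_eq, Finset.mul_sum]
  refine Finset.sum_congr rfl fun s hs => ?_
  simp only [Pi.smul_apply, smul_eq_mul, mul_pow, Finset.prod_mul_distrib,
    Finset.prod_pow_eq_pow_sum, ← hF.degree_eq_sum_deg_support hs]
  ring

/-- The forms vanishing on a set of points of projective space. -/
def vanishingForms (X : Set (ProjSpace K n)) : Set (MvPolynomial (Fin (n + 1)) K) :=
  {F | (∃ d, F.IsHomogeneous d) ∧ ∀ v ∈ cone X, eval v F = 0}

theorem eval_rep_eq_zero_iff {d : ℕ} (hF : F.IsHomogeneous d) {v : Fin (n + 1) → K} (hv : v ≠ 0) :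
    eval (Projectivization.mk K v hv).rep F = 0 ↔ eval v F = 0 := by
  obtain ⟨a, ha⟩ := Projectivization.exists_smul_eq_mk_rep K v hv
  rw [← ha, Units.smul_def, eval_smul_of_isHomogeneous hF]
  simp

theorem forall_eval_rep_eq_zero_iff {d : ℕ} (hF : F.IsHomogeneous d) :
    (∀ P ∈ X, eval P.rep F = 0) ↔ ∀ v ∈ cone X, eval v F = 0 :=
  ⟨fun h _ ⟨hv, hvX⟩ => (eval_rep_eq_zero_iff hF hv).mp (h _ hvX),
    fun h _ hP => h _ (rep_mem_cone.mpr hP)⟩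

theorem homogeneousIdeal_eq_span : homogeneousIdeal X = Ideal.span (vanishingForms X) :=
  congrArg Ideal.span (Set.ext fun _ =>
    and_congr_right fun ⟨_, hd⟩ => forall_eval_rep_eq_zero_iff hd)

theorem eval_eq_zero_of_mem_homogeneousIdeal (hF : F ∈ homogeneousIdeal X) {v : Fin (n + 1) → K}
    (hv : v ∈ cone X) : eval v F = 0 := by
  have : homogeneousIdeal X ≤ RingHom.ker (eval v) :=
    homogeneousIdeal_eq_span.trans_le (Ideal.span_le.mpr fun G hG => hG.2 v hv)
  exact this hF

theorem isClosed_iff_isAlgebraicSet : IsClosed X ↔ IsAlgebraicSet X := by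
  rw [← isOpen_compl_iff]
  change IsAlgebraicSet Xᶜᶜ ↔ _
  rw [compl_compl]

theorem mem_cone_projZeros {S : Set (MvPolynomial (Fin (n + 1)) K)}
    (hS : ∀ F ∈ S, ∃ d, F.IsHomogeneous d) {v : Fin (n + 1) → K} (hv : v ≠ 0) :
    v ∈ cone (projZeros S) ↔ ∀ F ∈ S, eval v F = 0 := by
  rw [mem_cone_iff hv]
  exact forall₂_congr fun F hF => have ⟨_, hd⟩ := hS F hF; eval_rep_eq_zero_iff hd hv

theorem isClosed_iff_forall_vanishingForms :
    IsClosed X ↔ ∀ v ≠ 0, (∀ F ∈ vanishingForms X, eval v F = 0) → v ∈ cone X := by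
  rw [isClosed_iff_isAlgebraicSet]
  constructor
  · rintro ⟨S, hS, rfl⟩ v hv hvS
    rw [mem_cone_projZeros hS hv]
    exact fun F hF => hvS F ⟨hS F hF, fun w hw => (mem_cone_projZeros hS hw.1).mp hw F hF⟩
  · refine fun h => ⟨vanishingForms X, fun F hF => hF.1, Set.ext fun P => ?_⟩
    exact ⟨fun hP F hF => hF.2 _ (rep_mem_cone.mpr hP),
      fun hP => rep_mem_cone.mp (h _ P.rep_nonzero hP)⟩

theorem isIrreducible_iff_forall_isHomogeneous :
    IsIrreducible X ↔ X.Nonempty ∧ ∀ (F G : MvPolynomial (Fin (n + 1)) K) (d e : ℕ),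
      F.IsHomogeneous d → G.IsHomogeneous e → (∃ v ∈ cone X, eval v F ≠ 0) →
        (∃ v ∈ cone X, eval v G ≠ 0) → ∃ v ∈ cone X, eval v F ≠ 0 ∧ eval v G ≠ 0 := by
  refine and_congr_right fun _ => ⟨?_, ?_⟩
  · rintro hX F G d e hF hG ⟨v, ⟨hv, hvX⟩, hFv⟩ ⟨w, ⟨hw, hwX⟩, hGw⟩
    have isOpen_ne {F : MvPolynomial (Fin (n + 1)) K} {d : ℕ} (hF : F.IsHomogeneous d) :
        IsOpen {P : ProjSpace K n | eval P.rep F ≠ 0} :=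
      isClosed_compl_iff.mp (isClosed_iff_isAlgebraicSet.mpr
        ⟨{F}, by simpa using ⟨d, hF⟩, by ext; simp [projZeros]⟩)
    obtain ⟨P, hP, hFP, hGP⟩ := hX _ _ (isOpen_ne hF) (isOpen_ne hG)
      ⟨_, hvX, (eval_rep_eq_zero_iff hF hv).not.mpr hFv⟩
      ⟨_, hwX, (eval_rep_eq_zero_iff hG hw).not.mpr hGw⟩
    exact ⟨P.rep, rep_mem_cone.mpr hP, hFP, hGP⟩
  · rintro h U V hU hV ⟨P, hPX, hPU⟩ ⟨Q, hQX, hQV⟩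
    obtain ⟨S, hS, hUS⟩ := isClosed_iff_isAlgebraicSet.mp hU.isClosed_compl
    obtain ⟨T, hT, hVT⟩ := isClosed_iff_isAlgebraicSet.mp hV.isClosed_compl
    rw [← compl_eq_comm] at hUS hVT
    subst hUS hVT
    simp only [projZeros, Set.mem_compl_iff, Set.mem_ofPred_eq, not_forall] at hPU hQV
    obtain ⟨F, hF, hFP⟩ := hPU
    obtain ⟨G, hG, hGQ⟩ := hQV
    obtain ⟨d, hd⟩ := hS F hF
    obtain ⟨e, he⟩ := hT G hG
    obtain ⟨v, ⟨hv, hvX⟩, hFv, hGv⟩ := h F G d e hd he ⟨_, rep_mem_cone.mpr hPX, hFP⟩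
      ⟨_, rep_mem_cone.mpr hQX, hGQ⟩
    exact ⟨_, hvX, fun hS => hFv ((eval_rep_eq_zero_iff hd hv).mp (hS F hF)),
      fun hT => hGv ((eval_rep_eq_zero_iff he hv).mp (hT G hG))⟩

theorem mem_homogeneousIdeal_iff_of_isHomogeneous {d : ℕ} (hF : F.IsHomogeneous d) :
    F ∈ homogeneousIdeal X ↔ ∀ v ∈ cone X, eval v F = 0 :=
  ⟨fun h _ hv => eval_eq_zero_of_mem_homogeneousIdeal h hv,
    fun h => homogeneousIdeal_eq_span.ge (Ideal.subset_span ⟨⟨d, hF⟩, h⟩)⟩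

theorem isPrime_homogeneousIdeal (hX : IsIrreducible X) : (homogeneousIdeal X).IsPrime := by
  let _ : GradedAlgebra (homogeneousSubmodule (Fin (n + 1)) K) := MvPolynomial.gradedAlgebra
  rw [isIrreducible_iff_forall_isHomogeneous] at hX
  refine (Ideal.homogeneous_span (homogeneousSubmodule (Fin (n + 1)) K) _
    fun _ hF => hF.1).isPrime_of_homogeneous_mem_or_mem ?_ ?_
  · obtain ⟨v, hv⟩ := cone_nonempty.mpr hX.1
    rw [Ideal.ne_top_iff_one]
    exact fun h => one_ne_zero ((map_one (eval v)).symm.trans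
      (eval_eq_zero_of_mem_homogeneousIdeal h hv))
  · rintro F G ⟨d, hF⟩ ⟨e, hG⟩ hFG
    rw [mem_homogeneousSubmodule] at hF hG
    change F * G ∈ homogeneousIdeal X at hFG
    change F ∈ homogeneousIdeal X ∨ G ∈ homogeneousIdeal X
    rw [mem_homogeneousIdeal_iff_of_isHomogeneous (hF.mul hG)] at hFG
    rw [mem_homogeneousIdeal_iff_of_isHomogeneous hF, mem_homogeneousIdeal_iff_of_isHomogeneous hG]
    by_contra! h
    obtain ⟨v, hv, hFv, hGv⟩ := hX.2 F G d e hF hG h.1 h.2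
    exact mul_ne_zero hFv hGv (by simpa using hFG v hv)

theorem eval_homogeneousComponent_eq_zero {K σ : Type*} [Field K] [Infinite K]
    {F : MvPolynomial σ K} {v : σ → K} (h : ∀ t : K, t ≠ 0 → eval (t • v) F = 0) (d : ℕ) :
    eval v (homogeneousComponent d F) = 0 := by
  let p : Polynomial K := ∑ i ∈ Finset.range (F.totalDegree + 1),
    Polynomial.C (eval v (homogeneousComponent i F)) * Polynomial.X ^ i
  have eval_p (t : K) : p.eval t = eval (t • v) F := by
    rw [← congrArg (eval (t • v)) (sum_homogeneousComponent F), map_sum, Polynomial.eval_finsetSum]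
    refine Finset.sum_congr rfl fun i _ => ?_
    rw [eval_smul_of_isHomogeneous (homogeneousComponent_isHomogeneous i F), Polynomial.eval_mul,
      Polynomial.eval_C, Polynomial.eval_pow, Polynomial.eval_X, mul_comm]
  have hp : p = 0 := by
    have hroots : ({0}ᶜ : Set K) ⊆ {t | p.IsRoot t} := fun t ht => (eval_p t).trans (h t ht)
    exact p.eq_zero_of_infinite_isRoot ((Set.finite_singleton 0).infinite_compl.mono hroots)
  have coeff_p : p.coeff d = eval v (homogeneousComponent d F) := by
    simp only [p, Polynomial.finsetSum_coeff, Polynomial.coeff_C_mul_X_pow]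
    rw [Finset.sum_ite_eq]
    refine ite_eq_left_iff.mpr fun hd => ?_
    rw [homogeneousComponent_eq_zero _ _ (by simpa using hd), map_zero]
  rw [← coeff_p, hp, Polynomial.coeff_zero]

theorem mem_homogeneousIdeal_iff [Infinite K] :
    F ∈ homogeneousIdeal X ↔ ∀ v ∈ cone X, eval v F = 0 := by
  refine ⟨fun hF v hv => eval_eq_zero_of_mem_homogeneousIdeal hF hv, fun h => ?_⟩
  rw [← sum_homogeneousComponent F]
  refine Ideal.sum_mem _ fun d _ => ?_
  rw [mem_homogeneousIdeal_iff_of_isHomogeneous (homogeneousComponent_isHomogeneous d F)]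
  exact fun v hv => eval_homogeneousComponent_eq_zero (fun t ht => h _ (smul_mem_cone ht hv)) d

end Forms

/-! ### Differentials and pullbacks of polynomials -/

section Differential

variable {R σ τ : Type*} [CommRing R]

theorem eval_bind₁ (f : τ → MvPolynomial σ R) (F : MvPolynomial τ R) (v : σ → R) :
    eval v (bind₁ f F) = eval (fun i => eval v (f i)) F :=
  eval₂Hom_bind₁ (RingHom.id R) v f F

variable [Fintype σ]

/-- The differential at the point `v` of a polynomial function, as a linear form. -/
def differential (v : σ → R) : MvPolynomial σ R →ₗ[R] (σ → R) →ₗ[R] R :=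
  ∑ j, ((aeval v).toLinearMap ∘ₗ (pderiv j).toLinearMap).smulRight (LinearMap.proj j)

theorem differential_apply (v : σ → R) (F : MvPolynomial σ R) (w : σ → R) :
    differential v F w = ∑ j, eval v (pderiv j F) * w j := by
  simp [differential, aeval_eq_eval]

theorem differential_mul (F G : MvPolynomial σ R) (v : σ → R) :
    differential v (F * G) = eval v F • differential v G + eval v G • differential v F := by
  refine LinearMap.ext fun w => ?_
  simp only [differential_apply, LinearMap.add_apply, LinearMap.smul_apply, smul_eq_mul,
    Derivation.leibniz, map_add, map_mul, add_mul, Finset.sum_add_distrib, Finset.mul_sum,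
    mul_assoc]

theorem differential_C (a : R) (v : σ → R) : differential v (C a) = 0 :=
  LinearMap.ext fun w => by simp [differential_apply]

theorem differential_X (i : σ) (v : σ → R) : differential v (X i) = LinearMap.proj i := by
  classical
  refine LinearMap.ext fun w => ?_
  simp [differential_apply, pderiv_X, Pi.single_apply]

theorem differential_self {F : MvPolynomial σ R} {d : ℕ} (hF : F.IsHomogeneous d) (v : σ → R) :
    differential v F v = d * eval v F := by
  have euler := congrArg (eval v) hF.sum_X_mul_pderiv
  simpa [differential_apply, mul_comm] using euler

theorem differential_smul {F : MvPolynomial σ R} {d : ℕ} (hF : F.IsHomogeneous d) (c : R)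
    (v : σ → R) : differential (c • v) F = c ^ (d - 1) • differential v F := by
  refine LinearMap.ext fun w => ?_
  simp only [differential_apply, eval_smul_of_isHomogeneous hF.pderiv, LinearMap.smul_apply,
    smul_eq_mul, Finset.mul_sum, mul_assoc]

theorem differential_bind₁ [Fintype τ] (f : τ → MvPolynomial σ R) (F : MvPolynomial τ R)
    (v w : σ → R) :
    differential v (bind₁ f F) w =
      differential (fun i => eval v (f i)) F fun i => differential v (f i) w := by
  induction F using MvPolynomial.induction_on with
  | C a => simp [differential_C]
  | add F G hF hG => simp [hF, hG]
  | mul_X F i hF => simp [differential_mul, differential_X, eval_bind₁, hF]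

variable [DecidableEq σ]

/-- A linear form on `R^σ` as a polynomial. -/
def linearForm (φ : (σ → R) →ₗ[R] R) : MvPolynomial σ R :=
  ∑ j, C (φ (Pi.single j 1)) * X j

theorem linearForm_isHomogeneous (φ : (σ → R) →ₗ[R] R) : (linearForm φ).IsHomogeneous 1 :=
  .sum _ _ _ fun j _ => isHomogeneous_C_mul_X _ j

theorem sum_apply_single_mul (φ : (σ → R) →ₗ[R] R) (v : σ → R) :
    ∑ j, φ (Pi.single j 1) * v j = φ v := by
  conv_rhs => rw [pi_eq_sum_univ' v]
  simp [mul_comm]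

theorem eval_linearForm (φ : (σ → R) →ₗ[R] R) (v : σ → R) : eval v (linearForm φ) = φ v := by
  simp [linearForm, sum_apply_single_mul]

theorem differential_linearForm (φ : (σ → R) →ₗ[R] R) (v : σ → R) :
    differential v (linearForm φ) = φ := by
  refine LinearMap.ext fun w => ?_
  simp [linearForm, differential_mul, differential_C, differential_X, LinearMap.sum_apply,
    sum_apply_single_mul]

/-- The composition of a polynomial function with a linear map. -/
def pullback (T : (σ → R) →ₗ[R] (τ → R)) (F : MvPolynomial τ R) : MvPolynomial σ R :=
  bind₁ (fun i => linearForm (LinearMap.proj i ∘ₗ T)) F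

theorem pullback_isHomogeneous (T : (σ → R) →ₗ[R] (τ → R)) {F : MvPolynomial τ R} {d : ℕ}
    (hF : F.IsHomogeneous d) : (pullback T F).IsHomogeneous d := by
  have := hF.aeval (fun i => linearForm (LinearMap.proj i ∘ₗ T)) fun i => linearForm_isHomogeneous _
  rwa [one_mul] at this

theorem eval_pullback (T : (σ → R) →ₗ[R] (τ → R)) (F : MvPolynomial τ R) (v : σ → R) :
    eval v (pullback T F) = eval (T v) F := by
  simp [pullback, eval_bind₁, eval_linearForm]

theorem differential_pullback [Fintype τ] (T : (σ → R) →ₗ[R] (τ → R)) (F : MvPolynomial τ R)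
    (v w : σ → R) :
    differential v (pullback T F) w = differential (T v) F (T w) := by
  simp [pullback, differential_bind₁, differential_linearForm, eval_linearForm]

end Differential

/-! ### Tangent spaces -/

section ZariskiTangentSpace

variable {R σ : Type*} [CommRing R] (I : Ideal (MvPolynomial σ R))

section

variable [Fintype σ]

/-- The Zariski tangent space at `v` of the affine scheme defined by an ideal, as the kernel of the
Jacobian matrix. -/
def zariskiTangentSpace (v : σ → R) : Submodule R (σ → R) :=
  ⨅ F ∈ I, LinearMap.ker (differential v F)

theorem mem_zariskiTangentSpace {I : Ideal (MvPolynomial σ R)} {v w : σ → R} :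
    w ∈ zariskiTangentSpace I v ↔ ∀ F ∈ I, differential v F w = 0 := by
  simp [zariskiTangentSpace]

theorem mem_zariskiTangentSpace_span {S : Set (MvPolynomial σ R)} {v w : σ → R}
    (hv : ∀ F ∈ S, eval v F = 0) :
    w ∈ zariskiTangentSpace (Ideal.span S) v ↔ ∀ F ∈ S, differential v F w = 0 := by
  rw [mem_zariskiTangentSpace]
  refine ⟨fun h F hF => h F (Ideal.subset_span hF), fun h F hF => ?_⟩
  have hle : Ideal.span S ≤ RingHom.ker (eval v) := Ideal.span_le.mpr hv
  induction hF using Submodule.span_induction with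
  | mem F hF => exact h F hF
  | zero => simp
  | add F G _ _ hF hG => simp [hF, hG]
  | smul G F hFS hF => simp [differential_mul, hF, RingHom.mem_ker.mp (hle hFS)]

end

variable [Algebra (MvPolynomial σ R ⧸ I) R] [IsScalarTower R (MvPolynomial σ R ⧸ I) R]

/-- The coordinates of an `R`-valued point of the scheme defined by an ideal; the point is given by
an algebra structure. -/
def pointCoords (i : σ) : R :=
  algebraMap (MvPolynomial σ R ⧸ I) R (Ideal.Quotient.mk I (X i))

theorem algebraMap_mk_eq_eval (F : MvPolynomial σ R) :
    algebraMap (MvPolynomial σ R ⧸ I) R (Ideal.Quotient.mk I F) = eval (pointCoords I) F := by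
  have := aeval_unique ((IsScalarTower.toAlgHom R (MvPolynomial σ R ⧸ I) R).comp
    (Ideal.Quotient.mkₐ R I))
  exact DFunLike.congr_fun this F

variable [Fintype σ]

theorem derivation_mk (D : Derivation R (MvPolynomial σ R ⧸ I) R) (F : MvPolynomial σ R) :
    D (Ideal.Quotient.mk I F) =
      differential (pointCoords I) F fun j => D (Ideal.Quotient.mk I (X j)) := by
  induction F using MvPolynomial.induction_on with
  | C a => exact (D.map_algebraMap a).trans (by simp [differential_C])
  | add F G hF hG => simp [hF, hG]
  | mul_X F i hF =>
    simp [differential_mul, differential_X, Algebra.smul_def, algebraMap_mk_eq_eval, hF]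

theorem exists_derivation_mk_eq {w : σ → R} (hw : w ∈ zariskiTangentSpace I (pointCoords I)) :
    ∃ D : Derivation R (MvPolynomial σ R ⧸ I) R, ∀ F,
      D (Ideal.Quotient.mk I F) = differential (pointCoords I) F w := by
  let δ : (MvPolynomial σ R ⧸ I) →ₗ[R] R :=
    Submodule.liftQ (I.restrictScalars R) ((differential (pointCoords I)).flip w)
      (mem_zariskiTangentSpace.mp hw)
  refine ⟨Derivation.mk' δ fun a b => ?_, fun F => rfl⟩
  obtain ⟨F, rfl⟩ := Ideal.Quotient.mk_surjective a
  obtain ⟨G, rfl⟩ := Ideal.Quotient.mk_surjective b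
  rw [Algebra.smul_def, Algebra.smul_def, algebraMap_mk_eq_eval, algebraMap_mk_eq_eval]
  exact DFunLike.congr_fun (differential_mul F G (pointCoords I)) w

theorem finrank_derivation_quotient :
    Module.finrank R (Derivation R (MvPolynomial σ R ⧸ I) R) =
      Module.finrank R (zariskiTangentSpace I (pointCoords I)) := by
  let Φ : Derivation R (MvPolynomial σ R ⧸ I) R →ₗ[R] (σ → R) :=
    { toFun := fun D j => D (Ideal.Quotient.mk I (X j))
      map_add' := fun _ _ => rfl
      map_smul' := fun _ _ => rfl }
  have injective_Φ : Function.Injective Φ := fun D D' h => by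
    ext x
    obtain ⟨F, rfl⟩ := Ideal.Quotient.mk_surjective x
    rw [derivation_mk, derivation_mk]
    exact congrArg _ h
  have range_Φ : LinearMap.range Φ = zariskiTangentSpace I (pointCoords I) := by
    ext w
    constructor
    · rintro ⟨D, rfl⟩
      refine mem_zariskiTangentSpace.mpr fun F hF => (derivation_mk I D F).symm.trans ?_
      rw [Ideal.Quotient.eq_zero_iff_mem.mpr hF, map_zero]
    · intro hw
      obtain ⟨D, hD⟩ := exists_derivation_mk_eq I hw
      exact ⟨D, funext fun j => (hD (X j)).trans (by simp [differential_X])⟩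
  rw [← range_Φ, LinearMap.finrank_range_of_inj injective_Φ]

end ZariskiTangentSpace

section TangentSpace

variable {K : Type*} [Field K] {n m : ℕ} {X : Set (ProjSpace K n)} {Y : Set (ProjSpace K m)}
  {v w : Fin (n + 1) → K}

theorem tangentSpace_eq_zariskiTangentSpace (X : Set (ProjSpace K n)) (v : Fin (n + 1) → K) :
    tangentSpace X v = zariskiTangentSpace (homogeneousIdeal X) v := by
  ext w
  simp only [mem_zariskiTangentSpace, differential_apply]
  rfl

theorem mem_tangentSpace_iff (hv : v ∈ cone X) :
    w ∈ tangentSpace X v ↔ ∀ F ∈ vanishingForms X, differential v F w = 0 := by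
  rw [tangentSpace_eq_zariskiTangentSpace, homogeneousIdeal_eq_span,
    mem_zariskiTangentSpace_span fun F hF => hF.2 v hv]

theorem differential_eq_zero_of_mem_tangentSpace (hw : w ∈ tangentSpace X v)
    {F : MvPolynomial (Fin (n + 1)) K} (hF : F ∈ vanishingForms X) : differential v F w = 0 := by
  rw [tangentSpace_eq_zariskiTangentSpace, homogeneousIdeal_eq_span, mem_zariskiTangentSpace] at hw
  exact hw F (Ideal.subset_span hF)

theorem self_mem_tangentSpace (hv : v ∈ cone X) : v ∈ tangentSpace X v := by
  rw [mem_tangentSpace_iff hv]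
  rintro F ⟨⟨d, hd⟩, hF⟩
  rw [differential_self hd, hF v hv, mul_zero]

theorem tangentSpace_smul {c : K} (hc : c ≠ 0) (hv : v ∈ cone X) :
    tangentSpace X (c • v) = tangentSpace X v := by
  ext w
  rw [mem_tangentSpace_iff hv, mem_tangentSpace_iff (smul_mem_cone hc hv)]
  refine forall₂_congr fun F hF => ?_
  obtain ⟨d, hd⟩ := hF.1
  simp [differential_smul hd, hc]

theorem linearForm_mem_vanishingForms {W : Submodule K (Fin (n + 1) → K)} (hX : cone X ⊆ W)
    {φ : Module.Dual K (Fin (n + 1) → K)} (hφ : φ ∈ W.dualAnnihilator) :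
    linearForm φ ∈ vanishingForms X := by
  refine ⟨⟨1, linearForm_isHomogeneous φ⟩, fun v hv => ?_⟩
  rw [eval_linearForm, (W.mem_dualAnnihilator φ).mp hφ v (hX hv)]

theorem mem_of_forall_vanishingForms {W : Submodule K (Fin (n + 1) → K)} (hX : cone X ⊆ W)
    (hv : ∀ F ∈ vanishingForms X, eval v F = 0) : v ∈ W := by
  rw [← Subspace.forall_mem_dualAnnihilator_apply_eq_zero_iff]
  exact fun φ hφ => (eval_linearForm φ v).symm.trans (hv _ (linearForm_mem_vanishingForms hX hφ))

theorem tangentSpace_le {W : Submodule K (Fin (n + 1) → K)} (hX : cone X ⊆ W)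
    (v : Fin (n + 1) → K) : tangentSpace X v ≤ W := fun w hw => by
  rw [← Subspace.forall_mem_dualAnnihilator_apply_eq_zero_iff]
  intro φ hφ
  rw [← differential_linearForm φ v]
  exact differential_eq_zero_of_mem_tangentSpace hw (linearForm_mem_vanishingForms hX hφ)

theorem pullback_mem_vanishingForms {T : (Fin (n + 1) → K) →ₗ[K] (Fin (m + 1) → K)}
    (hT : ∀ x ∈ cone X, ∃ c : K, ∃ y ∈ cone Y, T x = c • y)
    {F : MvPolynomial (Fin (m + 1)) K} (hF : F ∈ vanishingForms Y) :
    pullback T F ∈ vanishingForms X := by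
  obtain ⟨⟨d, hd⟩, hFY⟩ := hF
  refine ⟨⟨d, pullback_isHomogeneous T hd⟩, fun x hx => ?_⟩
  obtain ⟨c, y, hy, hxy⟩ := hT x hx
  rw [eval_pullback, hxy, eval_smul_of_isHomogeneous hd, hFY y hy, mul_zero]

theorem map_mem_tangentSpace {T : (Fin (n + 1) → K) →ₗ[K] (Fin (m + 1) → K)}
    (hT : ∀ x ∈ cone X, ∃ c : K, ∃ y ∈ cone Y, T x = c • y) (hTv : T v ∈ cone Y)
    (hw : w ∈ tangentSpace X v) : T w ∈ tangentSpace Y (T v) := by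
  refine (mem_tangentSpace_iff hTv).mpr fun F hF => ?_
  rw [← differential_pullback]
  exact differential_eq_zero_of_mem_tangentSpace hw (pullback_mem_vanishingForms hT hF)

/-- The evaluation of homogeneous coordinate ring elements at a vector of the cone. -/
def coordRingEval (hv : v ∈ cone X) :
    (MvPolynomial (Fin (n + 1)) K ⧸ homogeneousIdeal X) →ₐ[K] K :=
  Ideal.Quotient.liftₐ _ (aeval v) fun _ hF => eval_eq_zero_of_mem_homogeneousIdeal hF hv

theorem coordRingEval_mk (hv : v ∈ cone X) (F : MvPolynomial (Fin (n + 1)) K) :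
    coordRingEval hv (Ideal.Quotient.mk (homogeneousIdeal X) F) = eval v F :=
  rfl

theorem eq_zero_of_forall_coordRingEval [Infinite K]
    {f : MvPolynomial (Fin (n + 1)) K ⧸ homogeneousIdeal X}
    (hf : ∀ v (hv : v ∈ cone X), coordRingEval hv f = 0) : f = 0 := by
  obtain ⟨F, rfl⟩ := Ideal.Quotient.mk_surjective f
  exact Ideal.Quotient.eq_zero_iff_mem.mpr (mem_homogeneousIdeal_iff.mpr hf)

theorem exists_finrank_tangentSpace_eq_ringKrullDim [Infinite K] (hX : IsIrreducible X) :
    ∃ v ∈ cone X, (Module.finrank K (tangentSpace X v) : WithBot ℕ∞) =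
      ringKrullDim (MvPolynomial (Fin (n + 1)) K ⧸ homogeneousIdeal X) := by
  have := isPrime_homogeneousIdeal hX
  obtain ⟨g, hg, finrank_eq⟩ := exists_finrank_derivation_eq_ringKrullDim K
    (MvPolynomial (Fin (n + 1)) K ⧸ homogeneousIdeal X)
    fun f hf => eq_zero_of_forall_coordRingEval fun v hv => hf (coordRingEval hv)
  obtain ⟨v, hv, hgv⟩ : ∃ v, ∃ hv : v ∈ cone X, coordRingEval hv g ≠ 0 := by
    contrapose! hg
    exact eq_zero_of_forall_coordRingEval hg
  let _ : Algebra (MvPolynomial (Fin (n + 1)) K ⧸ homogeneousIdeal X) K :=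
    (coordRingEval hv).toRingHom.toAlgebra
  have : IsScalarTower K (MvPolynomial (Fin (n + 1)) K ⧸ homogeneousIdeal X) K :=
    .of_algHom (coordRingEval hv)
  have pointCoords_eq : pointCoords (homogeneousIdeal X) = v :=
    funext fun j => (coordRingEval_mk hv _).trans (eval_X j)
  refine ⟨v, hv, ?_⟩
  have h := finrank_eq K hgv
  rw [finrank_derivation_quotient, pointCoords_eq] at h
  rwa [tangentSpace_eq_zariskiTangentSpace]

end TangentSpace

/-! ### Linearly disjoint subspaces of an algebra -/

section LinearDisjoint

open TensorProduct

variable {K A : Type*} [Field K] [CommRing A] [Algebra K A] {V W : Submodule K A}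

/-- For linearly disjoint `V` and `W`, the linear map `V * W → V` that applies the functional `g` to
the second factor of products, extended arbitrarily to the ambient algebra. It recovers the first
factor of a product up to a scalar. -/
def leftFactor (hVW : V.LinearDisjoint W) (g : Module.Dual K A) : A →ₗ[K] A :=
  V.subtype ∘ₗ (TensorProduct.rid K V).toLinearMap ∘ₗ (g ∘ₗ W.subtype).lTensor V ∘ₗ
    (LinearMap.exists_leftInverse_of_injective (V := V ⊗[K] W) (V.mulMap W)
      (LinearMap.ker_eq_bot.mpr hVW.injective)).choose

theorem leftFactor_mulMap (hVW : V.LinearDisjoint W) (g : Module.Dual K A) (t : V ⊗[K] W) :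
    leftFactor hVW g (V.mulMap W t) = TensorProduct.rid K V ((g ∘ₗ W.subtype).lTensor V t) := by
  have leftInverse := (LinearMap.exists_leftInverse_of_injective (V := V ⊗[K] W) (V.mulMap W)
    (LinearMap.ker_eq_bot.mpr hVW.injective)).choose_spec
  exact congrArg (fun t => (TensorProduct.rid K V ((g ∘ₗ W.subtype).lTensor V t) : A))
    (LinearMap.congr_fun leftInverse t)

theorem leftFactor_mul (hVW : V.LinearDisjoint W) (g : Module.Dual K A) {p q : A} (hp : p ∈ V)
    (hq : q ∈ W) : leftFactor hVW g (p * q) = g q • p := by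
  simpa using leftFactor_mulMap hVW g ((⟨p, hp⟩ : V) ⊗ₜ (⟨q, hq⟩ : W))

theorem leftFactor_symm_mul (hVW : V.LinearDisjoint W) (f : Module.Dual K A) {p q : A} (hp : p ∈ V)
    (hq : q ∈ W) : leftFactor hVW.symm f (p * q) = f p • q := by
  rw [mul_comm, leftFactor_mul hVW.symm f hq hp]

theorem exists_leftFactor_ne_zero (hVW : V.LinearDisjoint W) {r : A} (hr : r ∈ V * W)
    (hr0 : r ≠ 0) : ∃ g, leftFactor hVW g r ≠ 0 := by
  classical
  rw [← Submodule.mulMap_range] at hr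
  obtain ⟨t, rfl⟩ := hr
  let b := Module.Basis.ofVectorSpace K W
  have ht : TensorProduct.equivFinsuppOfBasisRight b t ≠ 0 := by
    rintro h
    simp_all
  obtain ⟨j, hj⟩ := Finsupp.ne_iff.mp ht
  obtain ⟨g, hg⟩ := LinearMap.exists_extend (b.coord j)
  refine ⟨g, ?_⟩
  rwa [leftFactor_mulMap, hg, ← TensorProduct.equivFinsuppOfBasisRight_apply, Ne,
    ZeroMemClass.coe_eq_zero]

theorem mul_ne_zero_of_linearDisjoint (hVW : V.LinearDisjoint W) {p q : A} (hp : p ∈ V) (hq : q ∈ W)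
    (hp0 : p ≠ 0) (hq0 : q ≠ 0) : p * q ≠ 0 := by
  obtain ⟨g, hg⟩ := Module.Projective.exists_dual_ne_zero K hq0
  intro hpq
  have := leftFactor_mul hVW g hp hq
  rw [hpq, map_zero] at this
  exact smul_ne_zero hg hp0 this.symm

theorem map_mulRight_inf_map_mulLeft (hVW : V.LinearDisjoint W)
    {V' W' : Submodule K A} (hV' : V' ≤ V) (hW' : W' ≤ W) {p q : A} (hp : p ∈ V') (hq : q ∈ W')
    (hq0 : q ≠ 0) :
    V'.map (LinearMap.mulRight K q) ⊓ W'.map (LinearMap.mulLeft K p) = K ∙ (p * q) := by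
  apply le_antisymm
  · rintro _ ⟨⟨u, hu, rfl⟩, ⟨u', hu', h⟩⟩
    obtain ⟨g, hg⟩ := Module.Projective.exists_dual_ne_zero K hq0
    have hgu : g u' • p = g q • u := by
      rw [← leftFactor_mul hVW g (hV' hp) (hW' hu'), ← leftFactor_mul hVW g (hV' hu) (hW' hq)]
      exact congrArg _ h
    have hup : u = ((g q)⁻¹ * g u') • p := by
      rw [mul_smul, hgu, inv_smul_smul₀ hg]
    rw [LinearMap.mulRight_apply, hup, smul_mul_assoc]
    exact Submodule.smul_mem _ _ (Submodule.mem_span_singleton_self _)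
  · rw [Submodule.span_singleton_le_iff_mem]
    exact ⟨⟨p, hp, rfl⟩, ⟨q, hq, rfl⟩⟩

theorem finrank_map_of_disjoint_ker {E E' : Type*} [AddCommGroup E] [Module K E] [AddCommGroup E']
    [Module K E'] {f : E →ₗ[K] E'} {S : Submodule K E} (h : Disjoint S (LinearMap.ker f)) :
    Module.finrank K (S.map f) = Module.finrank K S := by
  rw [← LinearMap.range_domRestrict]
  exact LinearMap.finrank_range_of_inj (LinearMap.injective_domRestrict_iff.mpr h)

theorem injective_of_finrank_range_eq {E E' : Type*} [AddCommGroup E] [Module K E]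
    [FiniteDimensional K E] [AddCommGroup E'] [Module K E'] {f : E →ₗ[K] E'}
    (h : Module.finrank K (LinearMap.range f) = Module.finrank K E) : Function.Injective f := by
  have := f.finrank_range_add_finrank_ker
  exact LinearMap.ker_eq_bot.mp (Submodule.finrank_eq_zero.mp (by omega))

theorem finrank_mul_le (V W : Submodule K A) [FiniteDimensional K V] [FiniteDimensional K W] :
    Module.finrank K ↥(V * W) ≤ Module.finrank K V * Module.finrank K W := by
  rw [← Submodule.mulMap_range, ← Module.finrank_tensorProduct]
  exact LinearMap.finrank_range_le (M := V ⊗[K] W) (V.mulMap W)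

theorem linearDisjoint_of_finrank_mul_eq [FiniteDimensional K V] [FiniteDimensional K W]
    (h : Module.finrank K ↥(V * W) = Module.finrank K V * Module.finrank K W) :
    V.LinearDisjoint W := by
  rw [← Submodule.mulMap_range, ← Module.finrank_tensorProduct] at h
  exact ⟨injective_of_finrank_range_eq (E := V ⊗[K] W) h⟩

instance finiteDimensional_prod {ι : Type*} (s : Finset ι) (V : ι → Submodule K A)
    [∀ i, FiniteDimensional K (V i)] : FiniteDimensional K ↥(∏ i ∈ s, V i) := by
  refine Module.Finite.iff_fg.mpr (Finset.prod_induction V Submodule.FG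
    (fun _ _ => Submodule.FG.mul) ?_ fun i _ => Module.Finite.iff_fg.mp inferInstance)
  exact Submodule.one_eq_span (R := K) (A := A) ▸ Submodule.fg_span_singleton 1

theorem finrank_prod_le {ι : Type*} (s : Finset ι) (V : ι → Submodule K A)
    [∀ i, FiniteDimensional K (V i)] :
    Module.finrank K ↥(∏ i ∈ s, V i) ≤ ∏ i ∈ s, Module.finrank K (V i) := by
  classical
  induction s using Finset.induction_on with
  | empty =>
    rw [Finset.prod_empty, Finset.prod_empty, Submodule.one_eq_span]
    exact (finrank_span_le_card _).trans (by simp)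
  | insert i s hi ih =>
    rw [Finset.prod_insert hi, Finset.prod_insert hi]
    exact (finrank_mul_le _ _).trans (Nat.mul_le_mul_left _ ih)

end LinearDisjoint

/-! ### Hadamard products of two varieties -/

section HadamardPoints

open Pointwise

variable {K : Type*} [Field K] {n : ℕ} {X Y : Set (ProjSpace K n)}
  {V W : Submodule K (Fin (n + 1) → K)} {p q : Fin (n + 1) → K}

/-- The coordinatewise products of points of `X` and `Y`, whose closure is `hadamard X Y`. -/
def hadamardPoints (X Y : Set (ProjSpace K n)) : Set (ProjSpace K n) :=
  {R | ∃ (p q : Fin (n + 1) → K) (hp : p ≠ 0) (hq : q ≠ 0) (hpq : p * q ≠ 0),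
    Projectivization.mk K p hp ∈ X ∧ Projectivization.mk K q hq ∈ Y ∧
      R = Projectivization.mk K (p * q) hpq}

theorem mem_cone_hadamardPoints {r : Fin (n + 1) → K} :
    r ∈ cone (hadamardPoints X Y) ↔ r ≠ 0 ∧ ∃ p ∈ cone X, ∃ q ∈ cone Y, p * q = r := by
  constructor
  · rintro ⟨hr, p, q, hp, hq, hpq, hpX, hqY, h⟩
    obtain ⟨c, hc⟩ := (Projectivization.mk_eq_mk_iff' K _ _ hr hpq).mp h
    have hc0 : c ≠ 0 := by
      rintro rfl
      exact hr (by simpa using hc.symm)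
    exact ⟨hr, c • p, smul_mem_cone hc0 ⟨hp, hpX⟩, q, ⟨hq, hqY⟩, by rw [smul_mul_assoc, hc]⟩
  · rintro ⟨hr, p, ⟨hp, hpX⟩, q, ⟨hq, hqY⟩, rfl⟩
    exact ⟨hr, p, q, hp, hq, hr, hpX, hqY, rfl⟩

theorem hadamardPoints_comm (X Y : Set (ProjSpace K n)) :
    hadamardPoints X Y = hadamardPoints Y X := by
  refine cone_injective (Set.ext fun r => ?_)
  simp only [mem_cone_hadamardPoints, ← Set.mem_mul, mul_comm]

theorem cone_hadamardPoints (hVW : V.LinearDisjoint W) (hX : cone X ⊆ V) (hY : cone Y ⊆ W) :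
    cone (hadamardPoints X Y) = cone X * cone Y := by
  ext r
  rw [mem_cone_hadamardPoints, Set.mem_mul, and_iff_right_iff_imp]
  rintro ⟨p, hp, q, hq, rfl⟩
  exact mul_ne_zero_of_linearDisjoint hVW (hX hp) (hY hq) (ne_zero_of_mem_cone hp)
    (ne_zero_of_mem_cone hq)

theorem cone_hadamardPoints_subset (hX : cone X ⊆ V) (hY : cone Y ⊆ W) :
    cone (hadamardPoints X Y) ⊆ (V * W : Submodule K (Fin (n + 1) → K)) := fun r hr => by
  obtain ⟨-, p, hp, q, hq, rfl⟩ := mem_cone_hadamardPoints.mp hr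
  exact Submodule.mul_mem_mul (hX hp) (hY hq)

theorem leftFactor_mem_smul_cone (hVW : V.LinearDisjoint W) (hX : cone X ⊆ V) (hY : cone Y ⊆ W)
    (g : Module.Dual K (Fin (n + 1) → K)) :
    ∀ r ∈ cone (hadamardPoints X Y), ∃ c : K, ∃ p ∈ cone X, leftFactor hVW g r = c • p := by
  intro r hr
  obtain ⟨-, p, hp, q, hq, rfl⟩ := mem_cone_hadamardPoints.mp hr
  exact ⟨g q, p, hp, leftFactor_mul hVW g (hX hp) (hY hq)⟩

theorem leftFactor_symm_mem_smul_cone (hVW : V.LinearDisjoint W) (hX : cone X ⊆ V)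
    (hY : cone Y ⊆ W) (f : Module.Dual K (Fin (n + 1) → K)) :
    ∀ r ∈ cone (hadamardPoints X Y), ∃ c : K, ∃ q ∈ cone Y, leftFactor hVW.symm f r = c • q :=
  hadamardPoints_comm X Y ▸ leftFactor_mem_smul_cone hVW.symm hY hX f

/-- The quadratic form `r ↦ f (T r) * r k - T r k * S r k`. If `T` and `S` recover the two factors
of products `r` up to scalars, these forms express that `r` is proportional to `T r * S r`. -/
def factorRelation (T S : (Fin (n + 1) → K) →ₗ[K] (Fin (n + 1) → K))
    (f : Module.Dual K (Fin (n + 1) → K)) (k : Fin (n + 1)) : MvPolynomial (Fin (n + 1)) K :=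
  linearForm (f ∘ₗ T) * MvPolynomial.X k -
    linearForm (LinearMap.proj k ∘ₗ T) * linearForm (LinearMap.proj k ∘ₗ S)

theorem eval_factorRelation (T S : (Fin (n + 1) → K) →ₗ[K] (Fin (n + 1) → K))
    (f : Module.Dual K (Fin (n + 1) → K)) (k : Fin (n + 1)) (r : Fin (n + 1) → K) :
    eval r (factorRelation T S f k) = f (T r) * r k - T r k * S r k := by
  simp [factorRelation, eval_linearForm]

theorem differential_factorRelation (T S : (Fin (n + 1) → K) →ₗ[K] (Fin (n + 1) → K))
    (f : Module.Dual K (Fin (n + 1) → K)) (k : Fin (n + 1)) (r w : Fin (n + 1) → K) :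
    differential r (factorRelation T S f k) w =
      f (T r) * w k + r k * f (T w) - (T r k * S w k + S r k * T w k) := by
  simp [factorRelation, eval_linearForm, differential_mul, differential_linearForm,
    differential_X]

theorem factorRelation_mem_vanishingForms (hVW : V.LinearDisjoint W) (hX : cone X ⊆ V)
    (hY : cone Y ⊆ W) (f g : Module.Dual K (Fin (n + 1) → K)) (k : Fin (n + 1)) :
    factorRelation (leftFactor hVW g) (leftFactor hVW.symm f) f k ∈
      vanishingForms (hadamardPoints X Y) := by
  refine ⟨⟨2, ?_⟩, fun r hr => ?_⟩
  · exact ((linearForm_isHomogeneous _).mul (isHomogeneous_X K k)).sub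
      ((linearForm_isHomogeneous _).mul (linearForm_isHomogeneous _))
  · obtain ⟨-, p, hp, q, hq, rfl⟩ := mem_cone_hadamardPoints.mp hr
    rw [eval_factorRelation, leftFactor_mul hVW g (hX hp) (hY hq),
      leftFactor_symm_mul hVW f (hX hp) (hY hq)]
    simp only [map_smul, smul_eq_mul, Pi.mul_apply, Pi.smul_apply]
    ring

theorem smul_eq_leftFactor_mul (hVW : V.LinearDisjoint W) (hX : cone X ⊆ V) (hY : cone Y ⊆ W)
    {r : Fin (n + 1) → K} (hr : ∀ F ∈ vanishingForms (hadamardPoints X Y), eval r F = 0)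
    (f g : Module.Dual K (Fin (n + 1) → K)) :
    f (leftFactor hVW g r) • r = leftFactor hVW g r * leftFactor hVW.symm f r := by
  ext k
  have := hr _ (factorRelation_mem_vanishingForms hVW hX hY f g k)
  rw [eval_factorRelation] at this
  exact sub_eq_zero.mp this

theorem isClosed_hadamardPoints (hVW : V.LinearDisjoint W) (hX : cone X ⊆ V) (hY : cone Y ⊆ W)
    (hXc : IsClosed X) (hYc : IsClosed Y) : IsClosed (hadamardPoints X Y) := by
  rw [isClosed_iff_forall_vanishingForms] at hXc hYc ⊢
  intro r hr hrZ
  have hrVW : r ∈ V * W := mem_of_forall_vanishingForms (cone_hadamardPoints_subset hX hY) hrZ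
  obtain ⟨g, hg⟩ := exists_leftFactor_ne_zero hVW hrVW hr
  obtain ⟨f, hf⟩ := Module.Projective.exists_dual_ne_zero K hg
  have hmul := smul_eq_leftFactor_mul hVW hX hY hrZ f g
  have hp : leftFactor hVW g r ∈ cone X := hXc _ hg fun F hF => by
    rw [← eval_pullback]
    exact hrZ _ (pullback_mem_vanishingForms (leftFactor_mem_smul_cone hVW hX hY g) hF)
  have hq0 : leftFactor hVW.symm f r ≠ 0 := right_ne_zero_of_mul (hmul ▸ smul_ne_zero hf hr)
  have hq : leftFactor hVW.symm f r ∈ cone Y := hYc _ hq0 fun F hF => by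
    rw [← eval_pullback]
    exact hrZ _ (pullback_mem_vanishingForms (leftFactor_symm_mem_smul_cone hVW hX hY f) hF)
  refine mem_cone_hadamardPoints.mpr ⟨hr, _, smul_mem_cone (inv_ne_zero hf) hp, _, hq, ?_⟩
  rw [smul_mul_assoc, ← hmul, inv_smul_smul₀ hf]

theorem hadamard_eq_hadamardPoints (hVW : V.LinearDisjoint W) (hX : cone X ⊆ V) (hY : cone Y ⊆ W)
    (hXc : IsClosed X) (hYc : IsClosed Y) : hadamard X Y = hadamardPoints X Y :=
  (isClosed_hadamardPoints hVW hX hY hXc hYc).closure_eq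

theorem isIrreducible_hadamardPoints (hVW : V.LinearDisjoint W) (hX : cone X ⊆ V)
    (hY : cone Y ⊆ W) (hXi : IsIrreducible X) (hYi : IsIrreducible Y) :
    IsIrreducible (hadamardPoints X Y) := by
  rw [isIrreducible_iff_forall_isHomogeneous, ← cone_nonempty] at hXi hYi ⊢
  rw [cone_hadamardPoints hVW hX hY]
  refine ⟨hXi.1.mul hYi.1, ?_⟩
  rintro F G d e hF hG ⟨_, ⟨p₁, hp₁, q₁, hq₁, rfl⟩, hF₁⟩ ⟨_, ⟨p₂, hp₂, q₂, hq₂, rfl⟩, hG₂⟩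
  obtain ⟨q, hq, hFq, hGq⟩ := hYi.2 (pullback (LinearMap.mulLeft K p₁) F)
    (pullback (LinearMap.mulLeft K p₂) G) d e (pullback_isHomogeneous _ hF)
    (pullback_isHomogeneous _ hG) ⟨q₁, hq₁, by rwa [eval_pullback]⟩
    ⟨q₂, hq₂, by rwa [eval_pullback]⟩
  obtain ⟨p, hp, hFp, hGp⟩ := hXi.2 (pullback (LinearMap.mulRight K q) F)
    (pullback (LinearMap.mulRight K q) G) d e (pullback_isHomogeneous _ hF)
    (pullback_isHomogeneous _ hG) ⟨p₁, hp₁, by rwa [eval_pullback] at hFq ⊢⟩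
    ⟨p₂, hp₂, by rwa [eval_pullback] at hGq ⊢⟩
  rw [eval_pullback] at hFp hGp
  exact ⟨p * q, Set.mul_mem_mul hp hq, hFp, hGp⟩

end HadamardPoints

/-! ### Tangent spaces of Hadamard products -/

section TangentSpaceHadamard

open Pointwise

variable {K : Type*} [Field K] {n : ℕ} {X Y : Set (ProjSpace K n)}
  {V W : Submodule K (Fin (n + 1) → K)} {p q : Fin (n + 1) → K}

theorem mul_mem_cone_hadamardPoints (hVW : V.LinearDisjoint W) (hX : cone X ⊆ V) (hY : cone Y ⊆ W)
    (hp : p ∈ cone X) (hq : q ∈ cone Y) : p * q ∈ cone (hadamardPoints X Y) :=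
  cone_hadamardPoints hVW hX hY ▸ Set.mul_mem_mul hp hq

theorem map_mulRight_tangentSpace_le (hVW : V.LinearDisjoint W) (hX : cone X ⊆ V)
    (hY : cone Y ⊆ W) (hp : p ∈ cone X) (hq : q ∈ cone Y) :
    (tangentSpace X p).map (LinearMap.mulRight K q) ≤
      tangentSpace (hadamardPoints X Y) (p * q) := by
  have mul_mem : ∀ x ∈ cone X, LinearMap.mulRight K q x ∈ cone (hadamardPoints X Y) := fun x hx =>
    mul_mem_cone_hadamardPoints hVW hX hY hx hq
  refine Submodule.map_le_iff_le_comap.mpr fun u hu => ?_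
  exact map_mem_tangentSpace (T := LinearMap.mulRight K q)
    (fun x hx => ⟨1, _, mul_mem x hx, (one_smul K _).symm⟩) (mul_mem p hp) hu

theorem map_mulLeft_tangentSpace_le (hVW : V.LinearDisjoint W) (hX : cone X ⊆ V)
    (hY : cone Y ⊆ W) (hp : p ∈ cone X) (hq : q ∈ cone Y) :
    (tangentSpace Y q).map (LinearMap.mulLeft K p) ≤
      tangentSpace (hadamardPoints X Y) (p * q) := by
  have mulLeft_eq : LinearMap.mulLeft K p = LinearMap.mulRight K p := LinearMap.ext (mul_comm p)
  rw [hadamardPoints_comm, mul_comm, mulLeft_eq]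
  exact map_mulRight_tangentSpace_le hVW.symm hY hX hq hp

theorem leftFactor_mem_tangentSpace (hVW : V.LinearDisjoint W) (hX : cone X ⊆ V) (hY : cone Y ⊆ W)
    (hp : p ∈ cone X) (hq : q ∈ cone Y) {g : Module.Dual K (Fin (n + 1) → K)} (hg : g q ≠ 0)
    {w : Fin (n + 1) → K} (hw : w ∈ tangentSpace (hadamardPoints X Y) (p * q)) :
    leftFactor hVW g w ∈ tangentSpace X p := by
  have hpq := leftFactor_mul hVW g (hX hp) (hY hq)
  rw [← tangentSpace_smul hg hp, ← hpq]
  exact map_mem_tangentSpace (leftFactor_mem_smul_cone hVW hX hY g)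
    (hpq ▸ smul_mem_cone hg hp) hw

theorem leftFactor_symm_mem_tangentSpace (hVW : V.LinearDisjoint W) (hX : cone X ⊆ V)
    (hY : cone Y ⊆ W) (hp : p ∈ cone X) (hq : q ∈ cone Y) {f : Module.Dual K (Fin (n + 1) → K)}
    (hf : f p ≠ 0) {w : Fin (n + 1) → K} (hw : w ∈ tangentSpace (hadamardPoints X Y) (p * q)) :
    leftFactor hVW.symm f w ∈ tangentSpace Y q := by
  rw [hadamardPoints_comm, mul_comm] at hw
  exact leftFactor_mem_tangentSpace hVW.symm hY hX hq hp hf hw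

/-- The differential at `p * q` of the relations `smul_eq_leftFactor_mul`. -/
theorem smul_eq_of_mem_tangentSpace (hVW : V.LinearDisjoint W) (hX : cone X ⊆ V) (hY : cone Y ⊆ W)
    (hp : p ∈ cone X) (hq : q ∈ cone Y) (f g : Module.Dual K (Fin (n + 1) → K))
    {w : Fin (n + 1) → K} (hw : w ∈ tangentSpace (hadamardPoints X Y) (p * q)) :
    (f p * g q) • w = (f p • leftFactor hVW g w - f (leftFactor hVW g w) • p) * q +
      p * (g q • leftFactor hVW.symm f w) := by
  ext k
  have hk := differential_eq_zero_of_mem_tangentSpace hw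
    (factorRelation_mem_vanishingForms hVW hX hY f g k)
  rw [differential_factorRelation, leftFactor_mul hVW g (hX hp) (hY hq),
    leftFactor_symm_mul hVW f (hX hp) (hY hq)] at hk
  simp only [map_smul, Pi.smul_apply, smul_eq_mul, Pi.mul_apply, Pi.add_apply,
    Pi.sub_apply] at hk ⊢
  linear_combination hk

theorem tangentSpace_hadamardPoints (hVW : V.LinearDisjoint W) (hX : cone X ⊆ V)
    (hY : cone Y ⊆ W) (hp : p ∈ cone X) (hq : q ∈ cone Y) :
    tangentSpace (hadamardPoints X Y) (p * q) =
      (tangentSpace X p).map (LinearMap.mulRight K q) ⊔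
        (tangentSpace Y q).map (LinearMap.mulLeft K p) := by
  refine le_antisymm (fun w hw => ?_) (sup_le (map_mulRight_tangentSpace_le hVW hX hY hp hq)
    (map_mulLeft_tangentSpace_le hVW hX hY hp hq))
  obtain ⟨f, hf⟩ := Module.Projective.exists_dual_ne_zero K (ne_zero_of_mem_cone hp)
  obtain ⟨g, hg⟩ := Module.Projective.exists_dual_ne_zero K (ne_zero_of_mem_cone hq)
  rw [← Submodule.smul_mem_iff _ (mul_ne_zero hf hg),
    smul_eq_of_mem_tangentSpace hVW hX hY hp hq f g hw]
  refine Submodule.add_mem_sup (Submodule.mem_map_of_mem (f := LinearMap.mulRight K q) ?_)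
    (Submodule.mem_map_of_mem (f := LinearMap.mulLeft K p) ?_)
  · exact Submodule.sub_mem _
      (Submodule.smul_mem _ _ (leftFactor_mem_tangentSpace hVW hX hY hp hq hg hw))
      (Submodule.smul_mem _ _ (self_mem_tangentSpace hp))
  · exact Submodule.smul_mem _ _ (leftFactor_symm_mem_tangentSpace hVW hX hY hp hq hf hw)

theorem finrank_tangentSpace_hadamardPoints (hVW : V.LinearDisjoint W) (hX : cone X ⊆ V)
    (hY : cone Y ⊆ W) (hp : p ∈ cone X) (hq : q ∈ cone Y) :
    Module.finrank K (tangentSpace (hadamardPoints X Y) (p * q)) + 1 =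
      Module.finrank K (tangentSpace X p) + Module.finrank K (tangentSpace Y q) := by
  have hp0 := ne_zero_of_mem_cone hp
  have hq0 := ne_zero_of_mem_cone hq
  have disjoint_right : Disjoint (tangentSpace X p) (LinearMap.ker (LinearMap.mulRight K q)) := by
    refine Submodule.disjoint_def.mpr fun u hu huq => by_contra fun hu0 => ?_
    exact mul_ne_zero_of_linearDisjoint hVW (tangentSpace_le hX p hu) (hY hq) hu0 hq0 huq
  have disjoint_left : Disjoint (tangentSpace Y q) (LinearMap.ker (LinearMap.mulLeft K p)) := by
    refine Submodule.disjoint_def.mpr fun u hu hpu => by_contra fun hu0 => ?_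
    exact mul_ne_zero_of_linearDisjoint hVW (hX hp) (tangentSpace_le hY q hu) hp0 hu0 hpu
  rw [← finrank_map_of_disjoint_ker disjoint_right, ← finrank_map_of_disjoint_ker disjoint_left,
    ← Submodule.finrank_sup_add_finrank_inf_eq, ← tangentSpace_hadamardPoints hVW hX hY hp hq,
    map_mulRight_inf_map_mulLeft hVW (tangentSpace_le hX p) (tangentSpace_le hY q)
      (self_mem_tangentSpace hp) (self_mem_tangentSpace hq) hq0,
    finrank_span_singleton (mul_ne_zero_of_linearDisjoint hVW (hX hp) (hY hq) hp0 hq0)]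

theorem isSmooth_iff : IsSmooth X ↔ ∀ v ∈ cone X,
    (Module.finrank K (tangentSpace X v) : WithBot ℕ∞) =
    ringKrullDim (MvPolynomial (Fin (n + 1)) K ⧸ homogeneousIdeal X) :=
  ⟨fun h v hv => h v hv.1 hv.2, fun h v hv hvX => h v ⟨hv, hvX⟩⟩

theorem IsSmooth.finrank_tangentSpace_eq (hX : IsSmooth X) {v w : Fin (n + 1) → K}
    (hv : v ∈ cone X) (hw : w ∈ cone X) :
    Module.finrank K (tangentSpace X v) = Module.finrank K (tangentSpace X w) := by
  rw [isSmooth_iff] at hX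
  exact_mod_cast (hX v hv).trans (hX w hw).symm

theorem isSmooth_of_finrank_tangentSpace_eq [Infinite K] (hX : IsIrreducible X)
    (h : ∀ v ∈ cone X, ∀ w ∈ cone X,
      Module.finrank K (tangentSpace X v) = Module.finrank K (tangentSpace X w)) : IsSmooth X := by
  obtain ⟨w, hw, finrank_eq⟩ := exists_finrank_tangentSpace_eq_ringKrullDim hX
  exact isSmooth_iff.mpr fun v hv => h v hv w hw ▸ finrank_eq

theorem isSmooth_hadamardPoints [Infinite K] (hVW : V.LinearDisjoint W) (hX : cone X ⊆ V)
    (hY : cone Y ⊆ W) (hXi : IsIrreducible X) (hYi : IsIrreducible Y) (hXs : IsSmooth X)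
    (hYs : IsSmooth Y) : IsSmooth (hadamardPoints X Y) := by
  refine isSmooth_of_finrank_tangentSpace_eq (isIrreducible_hadamardPoints hVW hX hY hXi hYi) ?_
  rw [cone_hadamardPoints hVW hX hY]
  rintro _ ⟨p, hp, q, hq, rfl⟩ _ ⟨p', hp', q', hq', rfl⟩
  have h := finrank_tangentSpace_hadamardPoints hVW hX hY hp hq
  have h' := finrank_tangentSpace_hadamardPoints hVW hX hY hp' hq'
  rw [hXs.finrank_tangentSpace_eq hp hp', hYs.finrank_tangentSpace_eq hq hq', ← h'] at h
  exact Nat.add_right_cancel h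

end TangentSpaceHadamard

/-! ### Iterated Hadamard products -/

section JointlyLinearDisjoint

variable {K A : Type*} [Field K] [CommRing A] [Algebra K A]

open Pointwise in
theorem prod_subset_coe_prod {ι : Type*} [Fintype ι] {S : ι → Set A} {V : ι → Submodule K A}
    (h : ∀ i, S i ⊆ V i) : ∏ i, S i ⊆ (∏ i, V i : Submodule K A) := by
  have prod_eq_span := Submodule.prod_span (R := K) Finset.univ fun i => (V i : Set A)
  simp only [Submodule.span_eq] at prod_eq_span
  rw [prod_eq_span]
  exact (Set.finsetProd_subset_finsetProd _ _ _ fun i _ => h i).trans Submodule.subset_span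

/-- Nonzero finite-dimensional subspaces `V i` whose multiplication map `⨂ i, V i → A` is injective.
Since `∏ i, V i` is the image of that map, injectivity is encoded as an equality of dimensions. -/
structure JointlyLinearDisjoint {ι : Type*} [Fintype ι] (V : ι → Submodule K A) : Prop where
  finrank_pos : ∀ i, 0 < Module.finrank K (V i)
  finrank_prod : Module.finrank K ↥(∏ i, V i) = ∏ i, Module.finrank K (V i)

variable {m : ℕ} {V : Fin (m + 1) → Submodule K A}

theorem JointlyLinearDisjoint.finiteDimensional (hV : JointlyLinearDisjoint V) (i : Fin (m + 1)) :
    FiniteDimensional K (V i) :=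
  .of_finrank_pos (hV.finrank_pos i)

theorem JointlyLinearDisjoint.castSucc (hV : JointlyLinearDisjoint V) :
    JointlyLinearDisjoint fun i : Fin m => V i.castSucc where
  finrank_pos i := hV.finrank_pos i.castSucc
  finrank_prod := by
    have := hV.finiteDimensional
    refine (finrank_prod_le _ _).antisymm (Nat.le_of_mul_le_mul_right ?_
      (hV.finrank_pos (Fin.last m)))
    rw [← Fin.prod_univ_castSucc fun i => Module.finrank K (V i), ← hV.finrank_prod,
      Fin.prod_univ_castSucc]
    exact finrank_mul_le _ _

theorem JointlyLinearDisjoint.linearDisjoint_last (hV : JointlyLinearDisjoint V) :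
    (∏ i : Fin m, V i.castSucc).LinearDisjoint (V (Fin.last m)) := by
  have := hV.finiteDimensional
  apply linearDisjoint_of_finrank_mul_eq
  rw [hV.castSucc.finrank_prod, ← Fin.prod_univ_castSucc fun i => Module.finrank K (V i),
    ← hV.finrank_prod, Fin.prod_univ_castSucc]

end JointlyLinearDisjoint

section HadamardProd

open Pointwise

variable {K : Type*} [Field K] {n ℓ : ℕ} {V : Fin (ℓ + 1) → Submodule K (Fin (n + 1) → K)}
  {X : Fin (ℓ + 1) → Set (ProjSpace K n)}

theorem isClosed_and_cone_hadamardProd (hV : JointlyLinearDisjoint V)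
    (hXV : ∀ i, cone (X i) ⊆ V i) (hX : ∀ i, IsClosed (X i)) :
    IsClosed (hadamardProd ℓ X) ∧ cone (hadamardProd ℓ X) = ∏ i, cone (X i) := by
  induction ℓ with
  | zero => exact ⟨hX 0, by rw [Fin.prod_univ_one, hadamardProd]⟩
  | succ ℓ ih =>
    obtain ⟨init_closed, cone_init⟩ := ih hV.castSucc (fun i => hXV i.castSucc) fun _ => hX _
    have init_subset := cone_init ▸ prod_subset_coe_prod fun i : Fin (ℓ + 1) => hXV i.castSucc
    have hadamardProd_eq := hadamard_eq_hadamardPoints hV.linearDisjoint_last init_subset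
      (hXV (Fin.last _)) init_closed (hX _)
    rw [hadamardProd, hadamardProd_eq, Fin.prod_univ_castSucc, ← cone_init]
    exact ⟨isClosed_hadamardPoints hV.linearDisjoint_last init_subset (hXV _) init_closed (hX _),
      cone_hadamardPoints hV.linearDisjoint_last init_subset (hXV _)⟩

theorem cone_hadamardProd_subset (hV : JointlyLinearDisjoint V)
    (hXV : ∀ i, cone (X i) ⊆ V i) (hX : ∀ i, IsClosed (X i)) :
    cone (hadamardProd ℓ X) ⊆ (∏ i, V i : Submodule K (Fin (n + 1) → K)) := by
  rw [(isClosed_and_cone_hadamardProd hV hXV hX).2]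
  exact prod_subset_coe_prod hXV

theorem hadamardProd_succ_eq_hadamardPoints {V : Fin (ℓ + 2) → Submodule K (Fin (n + 1) → K)}
    {X : Fin (ℓ + 2) → Set (ProjSpace K n)} (hV : JointlyLinearDisjoint V)
    (hXV : ∀ i, cone (X i) ⊆ V i) (hX : ∀ i, IsClosed (X i)) :
    hadamardProd (ℓ + 1) X =
      hadamardPoints (hadamardProd ℓ fun i => X i.castSucc) (X (Fin.last (ℓ + 1))) :=
  hadamard_eq_hadamardPoints hV.linearDisjoint_last
    (cone_hadamardProd_subset hV.castSucc (fun i => hXV i.castSucc) fun _ => hX _) (hXV _)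
    (isClosed_and_cone_hadamardProd hV.castSucc (fun i => hXV i.castSucc) fun _ => hX _).1 (hX _)

theorem isVariety_hadamardProd (hV : JointlyLinearDisjoint V) (hXV : ∀ i, cone (X i) ⊆ V i)
    (hX : ∀ i, IsVariety (X i)) : IsVariety (hadamardProd ℓ X) := by
  refine ⟨(isClosed_and_cone_hadamardProd hV hXV fun i => (hX i).1).1, ?_⟩
  induction ℓ with
  | zero => exact (hX 0).2
  | succ ℓ ih =>
    rw [hadamardProd_succ_eq_hadamardPoints hV hXV fun i => (hX i).1]
    exact isIrreducible_hadamardPoints hV.linearDisjoint_last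
      (cone_hadamardProd_subset hV.castSucc (fun i => hXV i.castSucc) fun _ => (hX _).1) (hXV _)
      (ih hV.castSucc (fun i => hXV i.castSucc) fun _ => hX _) (hX _).2

theorem isSmooth_hadamardProd [Infinite K] (hV : JointlyLinearDisjoint V)
    (hXV : ∀ i, cone (X i) ⊆ V i) (hX : ∀ i, IsVariety (X i)) (hXs : ∀ i, IsSmooth (X i)) :
    IsSmooth (hadamardProd ℓ X) := by
  induction ℓ with
  | zero => exact hXs 0
  | succ ℓ ih =>
    rw [hadamardProd_succ_eq_hadamardPoints hV hXV fun i => (hX i).1]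
    exact isSmooth_hadamardPoints hV.linearDisjoint_last
      (cone_hadamardProd_subset hV.castSucc (fun i => hXV i.castSucc) fun _ => (hX _).1) (hXV _)
      (isVariety_hadamardProd hV.castSucc (fun i => hXV i.castSucc) fun _ => hX _).2 (hX _).2
      (ih hV.castSucc (fun i => hXV i.castSucc) (fun _ => hX _) fun _ => hXs _) (hXs _)

end HadamardProd

/-! ### The matrix of products -/

section ProductMatrix

variable {ι τ R K : Type*} [Fintype ι] {κ : ι → Type*} [CommRing R] [Field K]

/-- The matrix whose columns are the coordinatewise products of columns of the matrices `A i`. It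
represents the multiplication map of the column spaces of the `A i`. -/
def productMatrix (A : ∀ i, Matrix τ (κ i) R) : Matrix τ (∀ i, κ i) R :=
  Matrix.of fun k J => ∏ i, A i k (J i)

theorem productMatrix_mulVec [DecidableEq ι] [∀ i, Fintype (κ i)] (A : ∀ i, Matrix τ (κ i) R)
    (y : ∀ i, κ i → R) :
    (productMatrix A).mulVec (fun J => ∏ i, y i (J i)) = ∏ i, (A i).mulVec (y i) := by
  ext k
  simp only [Matrix.mulVec, dotProduct, productMatrix, Matrix.of_apply, Finset.prod_apply,
    Finset.prod_univ_sum, Fintype.piFinset_univ, Finset.prod_mul_distrib]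

theorem range_productMatrix [DecidableEq ι] [∀ i, Fintype (κ i)] (A : ∀ i, Matrix τ (κ i) R) :
    LinearMap.range (productMatrix A).mulVecLin = ∏ i, LinearMap.range (A i).mulVecLin := by
  have col_productMatrix : ∀ J, (productMatrix A).col J = ∏ i, (A i).col (J i) := fun J => by
    ext k
    simp [productMatrix]
  simp only [Matrix.range_mulVecLin, Submodule.prod_span]
  congr 1
  ext v
  rw [Set.mem_fintype_prod]
  constructor
  · rintro ⟨J, rfl⟩
    exact ⟨fun i => (A i).col (J i), fun i => ⟨J i, rfl⟩, (col_productMatrix J).symm⟩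
  · rintro ⟨c, hc, rfl⟩
    choose J hJ using hc
    exact ⟨J, by simp only [col_productMatrix, hJ]⟩

theorem rank_eq_card_iff_exists_det_submatrix_ne_zero {α β : Type*} [Finite α] [Fintype β]
    [DecidableEq β] (M : Matrix α β K) :
    M.rank = Fintype.card β ↔ ∃ s : β → α, (M.submatrix s id).det ≠ 0 := by
  constructor
  · intro hM
    obtain ⟨τ, a, ha, span_eq, linearIndependent⟩ := exists_linearIndependent' K M.row
    have : Finite τ := Finite.of_injective a ha
    have := Fintype.ofFinite τ
    have card_eq : Fintype.card τ = Fintype.card β := by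
      rw [← finrank_span_eq_card linearIndependent, span_eq, ← Matrix.rank_eq_finrank_span_row, hM]
    let e : β ≃ τ := (Fintype.equivOfCardEq card_eq).symm
    refine ⟨a ∘ e, IsUnit.ne_zero ((Matrix.isUnit_iff_isUnit_det _).mp ?_)⟩
    rw [← Matrix.linearIndependent_rows_iff_isUnit]
    exact linearIndependent.comp e e.injective
  · rintro ⟨s, hs⟩
    have mulVec_comp : Function.Injective ((· ∘ s) ∘ M.mulVec) :=
      Matrix.mulVec_injective_of_det_ne_zero hs
    rw [Matrix.rank, LinearMap.finrank_range_of_inj mulVec_comp.of_comp,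
      Module.finrank_fintype_fun_eq_card]

end ProductMatrix

/-! ### Generic tuples of linear subspaces -/

section Generic

variable {K : Type*} [Field K] {m n : ℕ} {h : Fin m → ℕ}

/-- The tuples of linear subspaces for which the multiplication map `L 0 ⊗ ⋯ ⊗ L (m - 1) → K^(n+1)`
is injective. -/
def genericTuples (K : Type*) [Field K] (n : ℕ) {m : ℕ} (h : Fin m → ℕ) :
    Set (∀ i, Grass K n (h i)) :=
  {L | JointlyLinearDisjoint fun i => (L i).1}

theorem mem_genericTuples_iff_rank {L : ∀ i, Grass K n (h i)}
    {A : ∀ i, Matrix (Fin (n + 1)) (Fin (h i + 1)) K}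
    (hA : ∀ i, (L i).1 = LinearMap.range (A i).mulVecLin) :
    L ∈ genericTuples K n h ↔ (productMatrix A).rank = Fintype.card (∀ i, Fin (h i + 1)) := by
  have card_eq : Fintype.card (∀ i, Fin (h i + 1)) = ∏ i, Module.finrank K (L i).1 := by
    simp [(L _).2]
  rw [Matrix.rank, range_productMatrix, card_eq, ← funext hA]
  exact ⟨fun hL => hL.finrank_prod, fun hL => ⟨fun i => by simp [(L i).2], hL⟩⟩

theorem isOpenGrass_genericTuples : IsOpenGrass (genericTuples K n h) := by
  let minor (s : (∀ i, Fin (h i + 1)) → Fin (n + 1)) :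
      MvPolynomial (Σ i : Fin m, Fin (n + 1) × Fin (h i + 1)) K :=
    ((productMatrix fun i => Matrix.of fun k j => X ⟨i, (k, j)⟩).submatrix s id).det
  refine ⟨Ideal.span (Set.range minor), fun A L hL => ?_⟩
  have aeval_minor : ∀ s, aeval (flatten A) (minor s) = ((productMatrix A).submatrix s id).det := by
    intro s
    rw [AlgHom.map_det]
    congr 1
    ext J J'
    simp [productMatrix, flatten]
  rw [mem_genericTuples_iff_rank hL, rank_eq_card_iff_exists_det_submatrix_ne_zero, zeroLocus_span]
  simp only [Set.mem_ofPred_eq, Set.forall_mem_range, aeval_minor, not_forall]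

theorem exists_productMatrix_submatrix_eq_one (e : (∀ i, Fin (h i + 1)) ↪ Fin (n + 1)) :
    ∃ A : ∀ i, Matrix (Fin (n + 1)) (Fin (h i + 1)) K,
      (∀ i, Function.Injective (A i).mulVecLin) ∧ (productMatrix A).submatrix e id = 1 := by
  classical
  let A (i : Fin m) : Matrix (Fin (n + 1)) (Fin (h i + 1)) K :=
    Matrix.of fun k j => if ∃ J, e J = k ∧ J i = j then 1 else 0
  have hA : ∀ i J j, A i (e J) j = if J i = j then 1 else 0 := by simp [A]
  refine ⟨A, fun i => (injective_iff_map_eq_zero _).mpr fun y hy => ?_, ?_⟩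
  · ext j
    have := congrFun hy (e (Function.update 0 i j))
    simpa [Matrix.mulVec, dotProduct, hA] using this
  · ext J J'
    simp [productMatrix, hA, Matrix.one_apply, Finset.prod_ite_zero, funext_iff]

theorem genericTuples_nonempty (hn : (∏ i, (h i + 1)) - 1 ≤ n) :
    (genericTuples K n h).Nonempty := by
  obtain ⟨e⟩ : Nonempty ((∀ i, Fin (h i + 1)) ↪ Fin (n + 1)) := by
    rw [Function.Embedding.nonempty_iff_card_le]
    simp only [Fintype.card_pi, Fintype.card_fin]
    omega
  obtain ⟨A, injective, submatrix_eq⟩ := exists_productMatrix_submatrix_eq_one (K := K) e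
  refine ⟨fun i => ⟨LinearMap.range (A i).mulVecLin, ?_⟩,
    (mem_genericTuples_iff_rank fun _ => rfl).mpr ?_⟩
  · simp [LinearMap.finrank_range_of_inj (injective i)]
  · exact (rank_eq_card_iff_exists_det_submatrix_ne_zero _).mpr ⟨e, by simp [submatrix_eq]⟩

end Generic

/-! ### Projective equivalence with the product variety -/

section ProductVariety

variable {K : Type*} [Field K]

theorem exists_linearEquiv_comp_eq {E E' : Type*} [AddCommGroup E] [Module K E] [AddCommGroup E']
    [Module K E'] [FiniteDimensional K E'] {M N : E →ₗ[K] E'} (hM : Function.Injective M)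
    (hN : Function.Injective N) : ∃ g : E' ≃ₗ[K] E', ∀ x, g (M x) = N x := by
  obtain ⟨g, hg⟩ := Submodule.exists_linearEquiv_restrict_eq
    ((LinearEquiv.ofInjective M hM).symm ≪≫ₗ LinearEquiv.ofInjective N hN)
  refine ⟨g, fun x => ?_⟩
  have := hg (LinearEquiv.ofInjective M hM x)
  rw [LinearEquiv.trans_apply, LinearEquiv.symm_apply_apply] at this
  exact this.symm

theorem exists_linearEquiv_prod_eq_segreVec {m n : ℕ} {h : Fin m → ℕ} {L : ∀ i, Grass K n (h i)}
    (hL : L ∈ genericTuples K n h) {φ : ∀ i, (Fin (h i + 1) → K) →ₗ[K] (Fin (n + 1) → K)}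
    (hφL : ∀ i, LinearMap.range (φ i) = (L i).1) (e : (∀ i, Fin (h i + 1)) ↪ Fin (n + 1)) :
    ∃ g : (Fin (n + 1) → K) ≃ₗ[K] (Fin (n + 1) → K),
      ∀ y : ∀ i, Fin (h i + 1) → K, g (∏ i, φ i (y i)) = segreVec e y := by
  let A (i : Fin m) := LinearMap.toMatrix' (φ i)
  have mulVecLin_A : ∀ i, (A i).mulVecLin = φ i := fun i => Matrix.toLin'_toMatrix' (φ i)
  have rank_eq := (mem_genericTuples_iff_rank fun i => by rw [mulVecLin_A, hφL]).mp hL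
  have injective : Function.Injective (productMatrix A).mulVecLin :=
    injective_of_finrank_range_eq (rank_eq.trans (Module.finrank_fintype_fun_eq_card K).symm)
  obtain ⟨g, hg⟩ := exists_linearEquiv_comp_eq injective
    (N := Function.ExtendByZero.linearMap K e) (Function.extend_injective e.injective 0)
  refine ⟨g, fun y => ?_⟩
  have prod_eq : ∏ i, φ i (y i) = (productMatrix A).mulVecLin fun J => ∏ i, y i (J i) := by
    simp only [← mulVecLin_A, Matrix.mulVecLin_apply, productMatrix_mulVec]
  rw [prod_eq, hg]
  rfl

theorem segreVec_smul {m n : ℕ} {h : Fin m → ℕ} (e : (∀ i, Fin (h i + 1)) ↪ Fin (n + 1))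
    (c : Fin m → K) (y : ∀ i, Fin (h i + 1) → K) :
    segreVec e (fun i => c i • y i) = (∏ i, c i) • segreVec e y := by
  have prod_smul : (fun J : ∀ i, Fin (h i + 1) => ∏ i, (c i • y i) (J i)) =
      (∏ i, c i) • fun J => ∏ i, y i (J i) := by
    ext J
    simp [Finset.prod_mul_distrib]
  rw [segreVec, prod_smul]
  exact (Function.ExtendByZero.linearMap K e).map_smul _ _

variable {n ℓ : ℕ} {h : Fin (ℓ + 1) → ℕ} {φ : ∀ i, (Fin (h i + 1) → K) →ₗ[K] (Fin (n + 1) → K)}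
  {X : Fin (ℓ + 1) → Set (ProjSpace K n)}

theorem cone_productVariety (e : (∀ i, Fin (h i + 1)) ↪ Fin (n + 1))
    (hφ : ∀ i, Function.Injective (φ i)) :
    cone (productVariety e φ hφ X) = segreVec e '' {y | ∀ i, φ i (y i) ∈ cone (X i)} := by
  have mem_iff : ∀ i (y : Fin (h i + 1) → K) (hy : y ≠ 0), φ i y ∈ cone (X i) ↔
      Projectivization.map (φ i) (hφ i) (Projectivization.mk K y hy) ∈ X i := fun i y hy =>
    mem_cone_iff ((map_ne_zero_iff _ (hφ i)).mpr hy)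
  ext v
  constructor
  · rintro ⟨hv, P, hP, hvP⟩
    obtain ⟨c, rfl⟩ := (Projectivization.mk_eq_mk_iff' K _ _ hv _).mp hvP.symm
    have hc : c ≠ 0 := left_ne_zero_of_smul hv
    refine ⟨fun i => Pi.mulSingle (M := fun _ => K) 0 c i • (P i).rep, fun i => ?_, ?_⟩
    · rw [map_smul]
      refine smul_mem_cone ?_ ((mem_iff i _ (P i).rep_nonzero).mpr ?_)
      · by_cases hi : i = 0
        · simpa [hi] using hc
        · simp [hi]
      · simpa only [Projectivization.mk_rep] using hP i
    · rw [segreVec_smul, Fintype.prod_pi_mulSingle']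
  · rintro ⟨y, hy, rfl⟩
    have hy0 : ∀ i, y i ≠ 0 := fun i hi => ne_zero_of_mem_cone (hy i) (by rw [hi, map_zero])
    refine (mem_cone_iff (segreVec_ne_zero e y hy0)).mpr
      ⟨fun i => Projectivization.mk K (y i) (hy0 i), fun i => (mem_iff i _ _).mp (hy i), ?_⟩
    choose a ha using fun i => Projectivization.exists_smul_eq_mk_rep K (y i) (hy0 i)
    rw [segre, Projectivization.mk_eq_mk_iff']
    refine ⟨∏ i, (a i : K), ?_⟩
    simp only [← ha, Units.smul_def, segreVec_smul]

open Pointwise in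
theorem projectivelyEquivalent_productVariety {L : ∀ i, Grass K n (h i)}
    (hL : L ∈ genericTuples K n h) (hXL : ∀ i, cone (X i) ⊆ (L i).1) {H : Set (ProjSpace K n)}
    (hH : cone H = ∏ i, cone (X i)) (hφ : ∀ i, Function.Injective (φ i))
    (hφL : ∀ i, LinearMap.range (φ i) = (L i).1) (e : (∀ i, Fin (h i + 1)) ↪ Fin (n + 1)) :
    ProjectivelyEquivalent H (productVariety e φ hφ X) := by
  obtain ⟨g, hg⟩ := exists_linearEquiv_prod_eq_segreVec hL hφL e
  refine ⟨g, cone_injective ?_⟩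
  rw [cone_image_map, hH, cone_productVariety]
  apply subset_antisymm
  · rintro _ ⟨r, hr, rfl⟩
    obtain ⟨p, hp, rfl⟩ := (Set.mem_fintype_prod _ _).mp hr
    choose y hy using fun i => LinearMap.mem_range.mp ((hφL i).symm ▸ hXL i (hp i))
    exact ⟨y, fun i => (hy i).symm ▸ hp i, by simp only [← hg, hy]⟩
  · rintro _ ⟨y, hy, rfl⟩
    exact ⟨_, (Set.mem_fintype_prod _ _).mpr ⟨_, hy, rfl⟩, hg y⟩

end ProductVariety

end HadamardVar

end

open HadamardVar in
theorem mainTheorem3_general {K : Type*} [Field K] [Infinite K] (n ℓ : ℕ) (h : Fin (ℓ + 1) → ℕ)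
    (hn : (∏ i, (h i + 1)) - 1 ≤ n) :
    ∃ U : Set (∀ i, Grass K n (h i)), IsOpenGrass U ∧ U.Nonempty ∧
      ∀ L ∈ U, ∀ X : Fin (ℓ + 1) → Set (ProjSpace K n),
        (∀ i, IsVariety (X i)) → (∀ i, X i ⊆ linearPoints (L i).1) →
          IsVariety (hadamardProd ℓ X) ∧
          (∀ (φ : ∀ i, (Fin (h i + 1) → K) →ₗ[K] (Fin (n + 1) → K))
            (hφ : ∀ i, Function.Injective (φ i)),
            (∀ i, LinearMap.range (φ i) = (L i).1) →
              ∀ e : (∀ i, Fin (h i + 1)) ↪ Fin (n + 1),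
                ProjectivelyEquivalent (hadamardProd ℓ X) (productVariety e φ hφ X)) ∧
          ((∀ i, IsSmooth (X i)) → IsSmooth (hadamardProd ℓ X)) := by
  refine ⟨genericTuples K n h, isOpenGrass_genericTuples, genericTuples_nonempty hn,
    fun L hL X hX hXL => ?_⟩
  have cone_subset := fun i => cone_subset_of_subset_linearPoints (hXL i)
  have cone_eq := (isClosed_and_cone_hadamardProd hL cone_subset fun i => (hX i).1).2
  exact ⟨isVariety_hadamardProd hL cone_subset hX,
    fun φ hφ hφL e => projectivelyEquivalent_productVariety hL cone_subset cone_eq hφ hφL e,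
    isSmooth_hadamardProd hL cone_subset hX⟩

open HadamardVar in
theorem mainTheorem3 {K : Type*} [Field K] [IsAlgClosed K] [CharZero K]
    (n ℓ : ℕ) (h : Fin (ℓ + 1) → ℕ) (hn : (∏ i, (h i + 1)) - 1 ≤ n) :
    ∃ U : Set (∀ i, Grass K n (h i)), IsOpenGrass U ∧ U.Nonempty ∧
      ∀ L ∈ U, ∀ X : Fin (ℓ + 1) → Set (ProjSpace K n),
        (∀ i, IsVariety (X i)) → (∀ i, X i ⊆ linearPoints (L i).1) →
          IsVariety (hadamardProd ℓ X) ∧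
          (∀ (φ : ∀ i, (Fin (h i + 1) → K) →ₗ[K] (Fin (n + 1) → K))
            (hφ : ∀ i, Function.Injective (φ i)),
            (∀ i, LinearMap.range (φ i) = (L i).1) →
              ∀ e : (∀ i, Fin (h i + 1)) ↪ Fin (n + 1),
                ProjectivelyEquivalent (hadamardProd ℓ X) (productVariety e φ hφ X)) ∧
          ((∀ i, IsSmooth (X i)) → IsSmooth (hadamardProd ℓ X)) :=
  mainTheorem3_general n ℓ h hn
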